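/- \textbf{Setting.} Let $\Lambda$ be a finite set (the lattice). On the $4^{|\Lambda|}$-dimensional Fock space generated from the vacuum by fermionic creation operators $c^\dagger_{x,\sigma}$ ($x\in\Lambda$, $\sigma\in\{\uparrow,\downarrow\}$), with adjoints $c_{x,\sigma}$, canonical anticommutation relations and $n_{x,\sigma}=c^\dagger_{x,\sigma}c_{x,\sigma}$, consider the Hubbard Hamiltonian $$H=\sum_{x,y\in\Lambda}\sum_{\sigma}t_{x,y}\,c^\dagger_{x,\sigma}c_{y,\sigma}+U\sum_{x\in\Lambda}n_{x,\uparrow}n_{x,\downarrow},$$ where $t_{x,y}=t_{y,x}\in\mathbb R$. Let $S^{(\alpha)}_{\rm tot}=\frac12\sum_{x}\sum_{\sigma,\tau}c^\dagger_{x,\sigma}(p^{(\alpha)})_{\sigma,\tau}c_{x,\tau}$ with the Pauli matrices $p^{(\alpha)}$, $\alpha=1,2,3$; a state $\Phi$ has total spin $S\ge 0$ if $\sum_\alpha (S^{(\alpha)}_{\rm tot})^2\Phi=S(S+1)\Phi$. The model is considered at half filling, i.e. on the subspace with exactly $|\Lambda|$ electrons; ground states are the eigenvectors of $H$ in this subspace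 for its lowest eigenvalue there. Assume that (a) the model is bipartite: $\Lambda=A\cup B$ with $A\cap B=\emptyset$, and $t_{x,y}=0$ whenever $x,y\in A$ or $x,y\in B$; (b) $\Lambda$ is connected through nonvanishing $t_{x,y}$: for all $x,y\in\Lambda$ there are sites $x=x_0,x_1,\dots,x_N=y$ with $t_{x_i,x_{i+1}}\neq0$ for $0\le i<N$; (c) $|\Lambda|$ is even; (d) $U>0$. \textbf{Theorem (Lieb).} Under these assumptions every ground state of the half-filled model has total spin $S_{\rm tot}=\bigl||A|-|B|\bigr|/2$, and the ground states are nondegenerate apart from the trivial spin degeneracy: the space of ground states has dimension exactly $2S_{\rm tot}+1=\bigl||A|-|B|\bigr|+1$. \textbf{Corollary (ferrimagnetism).} (i) Let $(\Lambda_n,t_n,A_n,B_n,U_n)_{n\in\mathbb N}$ be a sequence of models satisfying the assumptions, with $|\Lambda_n|\to\infty$ and $\bigl||A_n|-|B_n|\bigr|$ of the exact order of $|\Lambda_n|$ (i.e. for some constants $0<c\le C$, it lies between $c|\Lambda_n|$ and $C|\Lambda_n|$ for all large $n$). Then the half-filled models exhibit ferromagnetism in the broad sense: for each $n$ all ground states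 have a common total spin $S_n$, and $S_n$ is of the exact order of $|\Lambda_n|$. (ii) Let $L\ge 2$ be even, and let $\Lambda$ be the CuO lattice of side $L$ with periodic boundary conditions: its sites are the $L^2$ vertices of the square lattice $(\mathbb Z/L)^2$ (black sites) and the $2L^2$ midpoints (white sites) of the segments from $p$ to $p+e_1$ and from $p$ to $p+e_2$, $p\in(\mathbb Z/L)^2$; its bonds join each midpoint to the two end points of its segment. If $t$ is real symmetric and nonvanishing exactly on the bonds, and $U>0$, then $|\Lambda|=3L^2$, and the ground states of the half-filled model have total spin $S_{\rm tot}=L^2/2$ and are nondegenerate apart from the $(L^2+1)$-fold spin degeneracy. Consequently, along any sequence of even $L\to\infty$ (with arbitrary such $t$ and $U>0$ depending on $L$) the half-filled models on CuO lattices exhibit ferromagnetism in the broad sense. -/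

import Mathlib

open Filter Asymptotics

noncomputable section

namespace Hubbard

/-! ## The fermionic Fock space and the Hubbard Hamiltonian -/

section Fock

variable {Λ : Type*} [Fintype Λ] [DecidableEq Λ]

/-- The spin index: `0` stands for up and `1` for down. -/
abbrev Spin := Fin 2

/-- The Hilbert space of electrons on the lattice `Λ`, of dimension `4 ^ |Λ|`.  Its standard
orthonormal basis consists of the states `Ψ (X, Y)` in which the up-spin electrons occupy exactly
the sites of `X` and the down-spin electrons exactly the sites of `Y`. -/
abbrev Fock (Λ : Type*) [Fintype Λ] := EuclideanSpace ℂ (Finset Λ × Finset Λ)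

/-- The basis state obtained from the vacuum by applying first the creation operators of the
down-spin electrons on `Y` and then those of the up-spin electrons on `X`. -/
def occ (X Y : Finset Λ) : Fock Λ := EuclideanSpace.single (X, Y) 1

open Classical in
/-- The fermionic sign `(-1) ^ k`, where `k` is the number of sites of `X` that precede `x` in a
fixed total order of the sites. -/
def fsign (x : Λ) (X : Finset Λ) : ℂ := (-1) ^ (X.filter fun y => WellOrderingRel y x).card

/-- The creation operator of an electron with spin `σ` at the site `x`.  The modes are ordered
with all up modes before all down modes, whence the additional sign `(-1) ^ |X|` for spin down. -/
def create (x : Λ) (σ : Spin) : Module.End ℂ (Fock Λ) :=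
  (EuclideanSpace.basisFun (Finset Λ × Finset Λ) ℂ).toBasis.constr ℂ fun p =>
    if σ = 0 then
      if x ∈ p.1 then 0 else fsign x p.1 • occ (insert x p.1) p.2
    else
      if x ∈ p.2 then 0 else ((-1) ^ p.1.card * fsign x p.2) • occ p.1 (insert x p.2)

/-- The annihilation operator, the adjoint of the creation operator. -/
def annihilate (x : Λ) (σ : Spin) : Module.End ℂ (Fock Λ) := LinearMap.adjoint (create x σ)

/-- The number operator of electrons with spin `σ` at `x`. -/
def number (x : Λ) (σ : Spin) : Module.End ℂ (Fock Λ) := create x σ * annihilate x σ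

/-- The hopping Hamiltonian `∑ t x y c†_{x,σ} c_{y,σ}`. -/
def hopping (t : Matrix Λ Λ ℝ) : Module.End ℂ (Fock Λ) :=
  ∑ x, ∑ y, ∑ σ : Spin, (t x y : ℂ) • (create x σ * annihilate y σ)

/-- The on-site interaction `∑ U x n_{x,↑} n_{x,↓}`. -/
def interaction (U : Λ → ℝ) : Module.End ℂ (Fock Λ) :=
  ∑ x, (U x : ℂ) • (number x 0 * number x 1)

/-- The Hubbard Hamiltonian. -/
def hamiltonian (t : Matrix Λ Λ ℝ) (U : Λ → ℝ) : Module.End ℂ (Fock Λ) :=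
  hopping t + interaction U

/-- The total number operator. -/
def totalNumber (Λ : Type*) [Fintype Λ] [DecidableEq Λ] : Module.End ℂ (Fock Λ) :=
  ∑ x : Λ, (number x 0 + number x 1)

/-- The three Pauli matrices. -/
def pauli : Fin 3 → Matrix Spin Spin ℂ :=
  ![!![0, 1; 1, 0], !![0, -Complex.I; Complex.I, 0], !![1, 0; 0, -1]]

/-- The `α`-th component of the spin operator at the site `x`. -/
def siteSpin (α : Fin 3) (x : Λ) : Module.End ℂ (Fock Λ) :=
  (1 / 2 : ℂ) • ∑ σ : Spin, ∑ τ : Spin, pauli α σ τ • (create x σ * annihilate x τ)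

/-- The `α`-th component of the total spin operator. -/
def totalSpin (Λ : Type*) [Fintype Λ] [DecidableEq Λ] (α : Fin 3) : Module.End ℂ (Fock Λ) :=
  ∑ x : Λ, siteSpin α x

/-- The square of the total spin, `∑ α, (S_tot^α)²`. -/
def totalSpinSq (Λ : Type*) [Fintype Λ] [DecidableEq Λ] : Module.End ℂ (Fock Λ) :=
  ∑ α : Fin 3, totalSpin Λ α ^ 2

/-- The state `Φ` has total spin `S`, i.e. `(S_tot)² Φ = S (S + 1) Φ`. -/
def HasTotalSpin (S : ℝ) (Φ : Fock Λ) : Prop :=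
  0 ≤ S ∧ totalSpinSq Λ Φ = ((S * (S + 1) : ℝ) : ℂ) • Φ

/-- The subspace of states with exactly `N` electrons. -/
def sector (Λ : Type*) [Fintype Λ] [DecidableEq Λ] (N : ℕ) : Submodule ℂ (Fock Λ) :=
  (totalNumber Λ).eigenspace (N : ℂ)

/-- The energy eigenvalues of `H` on the states with exactly `N` electrons. -/
def energies (H : Module.End ℂ (Fock Λ)) (N : ℕ) : Set ℝ :=
  {E | ∃ Φ ∈ sector Λ N, Φ ≠ 0 ∧ H Φ = (E : ℂ) • Φ}

/-- The lowest energy eigenvalue of `H` on the states with exactly `N` electrons. -/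
def groundEnergy (H : Module.End ℂ (Fock Λ)) (N : ℕ) : ℝ := sInf (energies H N)

/-- The space of ground states of `H` with exactly `N` electrons (together with `0`). -/
def groundSpace (H : Module.End ℂ (Fock Λ)) (N : ℕ) : Submodule ℂ (Fock Λ) :=
  sector Λ N ⊓ H.eigenspace (groundEnergy H N : ℂ)

/-- With `N` electrons, the ground states of `H` have total spin `S`, and they are nondegenerate
apart from the trivial `(2 S + 1)`-fold spin degeneracy. -/
structure NondegenerateWithSpin (H : Module.End ℂ (Fock Λ)) (N : ℕ) (S : ℝ) : Prop where
  isLeast : IsLeast (energies H N) (groundEnergy H N)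
  hasTotalSpin : ∀ Φ ∈ groundSpace H N, HasTotalSpin S Φ
  degeneracy : (Module.finrank ℂ (groundSpace H N) : ℝ) = 2 * S + 1

end Fock

/-! ## Bipartite models -/

section Bipartite

variable {Λ : Type*} [Fintype Λ] [DecidableEq Λ]

/-- `Λ` is the disjoint union of `A` and `B`, and there is no hopping inside `A` or inside `B`. -/
structure IsBipartite (t : Matrix Λ Λ ℝ) (A B : Finset Λ) : Prop where
  disjoint : Disjoint A B
  union_eq : A ∪ B = Finset.univ
  left : ∀ x ∈ A, ∀ y ∈ A, t x y = 0
  right : ∀ x ∈ B, ∀ y ∈ B, t x y = 0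

/-- Any two sites are joined by a chain of sites with nonzero hopping between neighbours. -/
def IsConnected (t : Matrix Λ Λ ℝ) : Prop :=
  ∀ x y, Relation.ReflTransGen (fun u v => t u v ≠ 0) x y

/-- A bipartite Hubbard model with real symmetric hopping `t`, on a connected lattice with an even
number of sites, and with uniform repulsion `U > 0`. -/
structure IsLiebModel (t : Matrix Λ Λ ℝ) (A B : Finset Λ) (U : ℝ) : Prop where
  symm : t.IsSymm
  bipartite : IsBipartite t A B
  even_card : Even (Fintype.card Λ)
  connected : IsConnected t
  pos : 0 < U

end Bipartite

/-- Ferromagnetism in the broad sense, for a sequence of Hamiltonians `H n` on growing lattices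
`Λ n` with `N n` electrons: the ground states have a total spin, and it grows proportionally to
the number of sites. -/
def IsBroadlyFerromagnetic {Λ : ℕ → Type*} [∀ n, Fintype (Λ n)] [∀ n, DecidableEq (Λ n)]
    (H : ∀ n, Module.End ℂ (Fock (Λ n))) (N : ℕ → ℕ) : Prop :=
  Tendsto (fun n => Fintype.card (Λ n)) atTop atTop ∧
    ∃ S : ℕ → ℝ,
      (∀ n, IsLeast (energies (H n) (N n)) (groundEnergy (H n) (N n)) ∧
        ∀ Φ ∈ groundSpace (H n) (N n), HasTotalSpin (S n) Φ) ∧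
      S =Θ[atTop] fun n => (Fintype.card (Λ n) : ℝ)

/-! ## The CuO lattice -/

/-- The sites of the CuO lattice of side `L` with periodic boundary conditions.  The black sites
`Sum.inl (i, j)` form a square lattice; the white site `Sum.inr ((i, j), d)` is the midpoint of the
bond of the square lattice that leaves `(i, j)` in the direction `d`. -/
abbrev CuOSite (L : ℕ) := (ZMod L × ZMod L) ⊕ ((ZMod L × ZMod L) × Fin 2)

/-- The two unit vectors of the square lattice. -/
def unitVec (L : ℕ) : Fin 2 → ZMod L × ZMod L := ![(1, 0), (0, 1)]

/-- The bonds of the CuO lattice join each white site to the two black sites next to it. -/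
def CuOBond (L : ℕ) : CuOSite L → CuOSite L → Prop
  | Sum.inl p, Sum.inr (q, d) => p = q ∨ p = q + unitVec L d
  | Sum.inr (q, d), Sum.inl p => p = q ∨ p = q + unitVec L d
  | _, _ => False

/-- A hopping matrix on the CuO lattice that is nonvanishing exactly on the bonds. -/
structure IsCuOHopping {L : ℕ} (t : Matrix (CuOSite L) (CuOSite L) ℝ) : Prop where
  symm : t.IsSymm
  ne_zero_iff : ∀ u v, t u v ≠ 0 ↔ CuOBond L u v

end Hubbard

end

/-! A state is a matrix `W X Y` indexed by the up and the down configuration. Up-spin operators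
multiply `W` from the left, down-spin operators from the right. A particle-hole transformation of
the down spins, with an alternating sign on the two sublattices, preserves the bipartite hopping and
replaces `n` by `1 - n`. At half filling, `k` up electrons meet `k` down holes, so up to the
constant `U k` the Hamiltonian becomes `V ↦ T V + V T - U ∑ n_x V n_x` on square matrices
(`block_hamiltonian`): the repulsion has turned into an attraction.

This form has spin reflection positivity (`posSemidef_or_of_reflectionHam_eq`). Write a Hermitian
ground state as `V = A - B` with its positive and negative parts. The cross term `tr (A h B) = -U ∑
tr (A n_x B n_x)` is nonpositive, so `A` has the lowest energy too. The kernel of a semidefinite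
eigenstate is invariant under `T` and all `n_x`, which act irreducibly because the lattice is
connected (`IsConnected.eq_bot_or_eq_top`); so if `A` is nonzero it is invertible, and `A B = 0`
gives `B = 0`. Hence a ground state orthogonal to a positive diagonal state vanishes
(`eq_zero_of_reflectionHam_eq`).

The spin is read off from such a positive state, `ferriState`. With `|B| ≤ |A|` and `|B| ≤ k ≤ |A|`
it is an eigenvector of `S⁻S⁺` with eigenvalue `c = (|A| - k)(k + 1 - |B|)`. As `S⁻S⁺` is
self-adjoint and commutes with `H`, for a ground state `Φ` with `k` up electrons `(S⁻S⁺ - c) Φ` is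
again one, and is orthogonal to the reference state; so it is zero
(`lower_raise_of_mem_groundLevel`). Neither a limit of large `U` nor a continuity argument in `U` is
needed.

The factor `c` makes the spin ladder stop exactly at `k = |A|` and `k = |B|`, and be injective in
between. Therefore the overlaps with the `|A| - |B| + 1` reference states are coordinates on the
ground space (`finrank_groundSpace`). The CuO lattice is the case with `L²` black and `2 L²` white
sites. -/

noncomputable section

namespace Hubbard

set_option linter.unusedSectionVars false

/-! ### Spinless fermions as matrices indexed by configurations -/

section Spinless

variable {Λ : Type*} [Fintype Λ] [DecidableEq Λ]

open Classical in
/-- The sign picked up when `y` is inserted before the position of `x`. -/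
def orderSign (x y : Λ) : ℂ := if WellOrderingRel y x then -1 else 1

theorem orderSign_self (x : Λ) : orderSign x x = 1 := by
  simp [orderSign, irrefl]

/-- Of two distinct sites exactly one precedes the other. This single minus sign is the source of
the anticommutation relations at different sites. -/
theorem orderSign_mul_orderSign {x y : Λ} (h : x ≠ y) : orderSign x y * orderSign y x = -1 := by
  unfold orderSign
  rcases trichotomous_of WellOrderingRel x y with h1 | h1 | h1
  · simp [h1, asymm h1]
  · exact absurd h1 h
  · simp [h1, asymm h1]

theorem orderSign_mul_self (x y : Λ) : orderSign x y * orderSign x y = 1 := by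
  unfold orderSign; split_ifs <;> simp

theorem fsign_insert (x : Λ) {y : Λ} {X : Finset Λ} (h : y ∉ X) :
    fsign x (insert y X) = orderSign x y * fsign x X := by
  unfold fsign orderSign
  rw [Finset.filter_insert]
  split_ifs
  · rw [Finset.card_insert_of_notMem (by simp [h]), pow_succ]; ring
  · simp

theorem fsign_erase (x : Λ) {y : Λ} {X : Finset Λ} (h : y ∈ X) :
    fsign x (X.erase y) = orderSign x y * fsign x X := by
  conv_rhs => rw [← Finset.insert_erase h, fsign_insert x (Finset.notMem_erase y X),
    ← mul_assoc, orderSign_mul_self, one_mul]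

theorem fsign_mul_self (x : Λ) (X : Finset Λ) : fsign x X * fsign x X = 1 := by
  unfold fsign; rw [← mul_pow]; simp

theorem star_fsign (x : Λ) (X : Finset Λ) : star (fsign x X) = fsign x X := by
  simp [fsign]

theorem fsign_union (x : Λ) {X Y : Finset Λ} (h : Disjoint X Y) :
    fsign x (X ∪ Y) = fsign x X * fsign x Y := by
  classical
  unfold fsign
  rw [Finset.filter_union, Finset.card_union_of_disjoint, pow_add]
  exact Finset.disjoint_filter_filter h

/-- The matrix of the creation operator of a spinless fermion at `x`. -/
def creationMatrix (x : Λ) : Matrix (Finset Λ) (Finset Λ) ℂ :=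
  Matrix.of fun X' X => if x ∉ X ∧ X' = insert x X then fsign x X else 0

local notation "C" => creationMatrix

theorem creationMatrix_mul_apply {κ : Type*} (x : Λ) (M : Matrix (Finset Λ) κ ℂ) (X : Finset Λ)
    (j : κ) : (C x * M) X j = if x ∈ X then fsign x X * M (X.erase x) j else 0 := by
  rw [Matrix.mul_apply]
  split_ifs with h
  · rw [Finset.sum_eq_single (X.erase x)]
    · simp [creationMatrix, h, fsign_erase, orderSign_self]
    · intro Y _ hY
      have : ¬ (x ∉ Y ∧ X = insert x Y) := by
        rintro ⟨h1, rfl⟩; exact hY (by simp [h1])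
      simp [creationMatrix, this]
    · simp
  · apply Finset.sum_eq_zero
    intro Y _
    have : ¬ (x ∉ Y ∧ X = insert x Y) := by
      rintro ⟨h1, rfl⟩; exact h (by simp)
    simp [creationMatrix, this]

theorem transpose_creationMatrix_mul_apply {κ : Type*} (x : Λ) (M : Matrix (Finset Λ) κ ℂ)
    (X : Finset Λ) (j : κ) :
    ((C x).transpose * M) X j = if x ∈ X then 0 else fsign x X * M (insert x X) j := by
  rw [Matrix.mul_apply]
  split_ifs with h
  · exact Finset.sum_eq_zero fun Y _ => by simp [creationMatrix, h]
  · rw [Finset.sum_eq_single (insert x X)]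
    · simp [creationMatrix, h]
    · intro Y _ hY
      simp [creationMatrix, hY]
    · simp

theorem creationMatrix_anticomm (x y : Λ) : C x * C y + C y * C x = 0 := by
  -- With an arbitrary right factor the entrywise formula for the action of `C` can be applied
  -- twice; `M = 1` gives the claim.
  have key : ∀ M : Matrix (Finset Λ) (Finset Λ) ℂ, C x * (C y * M) + C y * (C x * M) = 0 := by
    intro M
    ext X Y
    simp only [Matrix.add_apply, creationMatrix_mul_apply, Matrix.zero_apply, Finset.mem_erase]
    by_cases hxy : x = y
    · subst hxy; simp
    by_cases hx : x ∈ X <;> by_cases hy : y ∈ X <;> simp [hx, hy, hxy, Ne.symm hxy]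
    rw [fsign_erase y hx, fsign_erase x hy, Finset.erase_right_comm]
    have h1 := orderSign_mul_orderSign hxy
    have h2 := orderSign_mul_self x y
    linear_combination (fsign x X * fsign y X * M ((X.erase y).erase x) Y) *
      (orderSign x y * h1 - orderSign y x * h2)
  simpa using key 1

theorem transpose_creationMatrix_anticomm (x y : Λ) :
    (C x).transpose * C y + C y * (C x).transpose = if x = y then 1 else 0 := by
  have key : ∀ M : Matrix (Finset Λ) (Finset Λ) ℂ,
      (C x).transpose * (C y * M) + C y * ((C x).transpose * M) = if x = y then M else 0 := by
    intro M
    ext X Y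
    simp only [Matrix.add_apply, creationMatrix_mul_apply, transpose_creationMatrix_mul_apply,
      Finset.mem_erase, Finset.mem_insert]
    by_cases hxy : x = y
    · subst hxy
      by_cases hx : x ∈ X
      · simp [hx, fsign_erase, orderSign_self, ← mul_assoc, fsign_mul_self]
      · simp [hx, fsign_insert, orderSign_self, ← mul_assoc, fsign_mul_self]
    by_cases hx : x ∈ X <;> by_cases hy : y ∈ X <;> simp [hx, hy, hxy, Ne.symm hxy]
    rw [fsign_insert y hx, fsign_erase x hy, Finset.erase_insert_of_ne hxy]
    have h1 := orderSign_mul_orderSign hxy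
    have h2 := orderSign_mul_self x y
    linear_combination (fsign x X * fsign y X * M (insert x (X.erase y)) Y) *
      (orderSign x y * h1 - orderSign y x * h2)
  have := key 1
  simpa using this

/-- The diagonal matrix with entries depending on the number of particles only. -/
def numDiag (g : ℕ → ℂ) : Matrix (Finset Λ) (Finset Λ) ℂ :=
  Matrix.diagonal fun X => g X.card

/-- Creation raises the particle number by one. Used for the parity and for the indicator of a fixed
particle number. -/
theorem numDiag_mul_creationMatrix (g : ℕ → ℂ) (x : Λ) :
    numDiag g * C x = C x * numDiag (fun n => g (n + 1)) := by
  ext X Y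
  simp only [numDiag, Matrix.diagonal_mul, Matrix.mul_diagonal, creationMatrix, Matrix.of_apply]
  split_ifs with h
  · rw [h.2, Finset.card_insert_of_notMem h.1, mul_comm]
  · simp

theorem transpose_numDiag (g : ℕ → ℂ) : (numDiag (Λ := Λ) g).transpose = numDiag g := by
  simp [numDiag]

theorem transpose_creationMatrix_mul_numDiag (g : ℕ → ℂ) (x : Λ) :
    (C x).transpose * numDiag g = numDiag (fun n => g (n + 1)) * (C x).transpose := by
  have := congrArg Matrix.transpose (numDiag_mul_creationMatrix g x)
  simpa [Matrix.transpose_mul, transpose_numDiag] using this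

theorem creationMatrix_mul_diagonal_mul (x : Λ) (g : Finset Λ → ℂ) :
    C x * Matrix.diagonal g * (C x).transpose =
      Matrix.diagonal fun X => if x ∈ X then g (X.erase x) else 0 := by
  ext X Y
  rw [Matrix.mul_assoc, creationMatrix_mul_apply, Matrix.diagonal_mul, Matrix.diagonal_apply]
  simp only [Matrix.transpose_apply, creationMatrix, Matrix.of_apply]
  by_cases hx : x ∈ X
  · by_cases hXY : X = Y
    · subst hXY
      simp only [hx, Finset.notMem_erase, Finset.insert_erase hx, if_true, fsign_erase,
        orderSign_self]
      simp only [not_false_eq_true, and_self, if_true, one_mul]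
      linear_combination g (X.erase x) * fsign_mul_self x X
    · simp [hx, hXY, Finset.insert_erase hx, Ne.symm hXY]
  · simp [hx]

theorem transpose_creationMatrix_mul_diagonal_mul (x : Λ) (g : Finset Λ → ℂ) :
    (C x).transpose * Matrix.diagonal g * C x =
      Matrix.diagonal fun X => if x ∈ X then 0 else g (insert x X) := by
  ext X Y
  rw [Matrix.mul_assoc, transpose_creationMatrix_mul_apply, Matrix.diagonal_mul,
    Matrix.diagonal_apply]
  simp only [creationMatrix, Matrix.of_apply]
  by_cases hx : x ∈ X
  · simp [hx]
  · by_cases hXY : X = Y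
    · subst hXY
      simp only [hx, not_false_eq_true, and_self, if_true, if_false]
      linear_combination g (insert x X) * fsign_mul_self x X
    · have : ¬ (x ∉ Y ∧ insert x X = insert x Y) := by
        rintro ⟨h1, h2⟩
        apply hXY
        rw [← Finset.erase_insert hx, h2, Finset.erase_insert h1]
      simp [hx, hXY, this]

/-- The matrix of the occupation number of a spinless fermion at `x`. -/
def numberMatrix (x : Λ) : Matrix (Finset Λ) (Finset Λ) ℂ :=
  Matrix.diagonal fun X => if x ∈ X then 1 else 0

theorem creationMatrix_mul_transpose (x : Λ) : C x * (C x).transpose = numberMatrix x := by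
  have := creationMatrix_mul_diagonal_mul x (fun _ => 1)
  rwa [Matrix.diagonal_one, Matrix.mul_one] at this

theorem conjTranspose_creationMatrix (x : Λ) : (C x).conjTranspose = (C x).transpose := by
  ext X Y
  simp only [Matrix.conjTranspose_apply, Matrix.transpose_apply, creationMatrix, Matrix.of_apply]
  split_ifs
  · exact star_fsign _ _
  · simp

theorem conjTranspose_transpose_creationMatrix (x : Λ) :
    (C x).transpose.conjTranspose = C x := by
  rw [← conjTranspose_creationMatrix, Matrix.conjTranspose_conjTranspose]

/-- The hopping Hamiltonian of a spinless fermion. -/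
def hopMatrix (t : Matrix Λ Λ ℝ) : Matrix (Finset Λ) (Finset Λ) ℂ :=
  ∑ x, ∑ y, (t x y : ℂ) • (C x * (C y).transpose)

theorem transpose_hopMatrix {t : Matrix Λ Λ ℝ} (ht : t.IsSymm) :
    (hopMatrix t).transpose = hopMatrix t := by
  unfold hopMatrix
  simp only [Matrix.transpose_sum, Matrix.transpose_smul, Matrix.transpose_mul,
    Matrix.transpose_transpose]
  rw [Finset.sum_comm]
  simp only [ht.apply]

theorem conjTranspose_hopMatrix {t : Matrix Λ Λ ℝ} (ht : t.IsSymm) :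
    (hopMatrix t).conjTranspose = hopMatrix t := by
  conv_rhs => rw [← transpose_hopMatrix ht]
  unfold hopMatrix
  simp only [Matrix.conjTranspose_sum, Matrix.conjTranspose_smul, Matrix.conjTranspose_mul,
    Matrix.transpose_sum, Matrix.transpose_smul, Matrix.transpose_mul,
    conjTranspose_transpose_creationMatrix, conjTranspose_creationMatrix, Matrix.transpose_transpose]
  simp

theorem numDiag_mul_hopMatrix (g : ℕ → ℂ) (t : Matrix Λ Λ ℝ) :
    numDiag g * hopMatrix t = hopMatrix t * numDiag g := by
  unfold hopMatrix
  simp only [Finset.mul_sum, Finset.sum_mul, Matrix.mul_smul, Matrix.smul_mul]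
  refine Finset.sum_congr rfl fun x _ => Finset.sum_congr rfl fun y _ => ?_
  rw [← Matrix.mul_assoc, numDiag_mul_creationMatrix, Matrix.mul_assoc, Matrix.mul_assoc,
    transpose_creationMatrix_mul_numDiag]

end Spinless

/-! ### Spin reflection positivity for an abstract attractive model -/

section SpinReflection

open scoped ComplexOrder MatrixOrder
open Matrix

variable {κ ι : Type*} [Fintype κ] [DecidableEq κ] [Fintype ι]

/-- With `A = M† M`, cyclicity turns the trace into that of `M B M†`, which is positive
semidefinite. -/
theorem _root_.Matrix.PosSemidef.trace_mul_nonneg {A B : Matrix κ κ ℂ} (hA : A.PosSemidef)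
    (hB : B.PosSemidef) : 0 ≤ (A * B).trace := by
  obtain ⟨M, rfl⟩ := CStarAlgebra.nonneg_iff_eq_star_mul_self.mp hA.nonneg
  rw [Matrix.mul_assoc, Matrix.trace_mul_comm]
  exact (hB.mul_mul_conjTranspose_same M).trace_nonneg

/-- Positive and negative parts from the functional calculus. Their orthogonality is what removes
the kinetic cross terms later. -/
theorem _root_.Matrix.IsHermitian.exists_posSemidef_sub {V : Matrix κ κ ℂ} (hV : V.IsHermitian) :
    ∃ A B : Matrix κ κ ℂ, A.PosSemidef ∧ B.PosSemidef ∧ V = A - B ∧ A * B = 0 ∧ B * A = 0 :=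
  ⟨V⁺, V⁻, Matrix.nonneg_iff_posSemidef.mp (CFC.posPart_nonneg V),
    Matrix.nonneg_iff_posSemidef.mp (CFC.negPart_nonneg V),
    (CFC.posPart_sub_negPart V hV.isSelfAdjoint).symm, CFC.posPart_mul_negPart V,
    CFC.negPart_mul_posPart V⟩

/-- The Hamiltonian `V ↦ T V + V T - U ∑ x, n x V n x` of a system with reflection symmetric
attractive interaction, acting on matrices. -/
def reflectionHam (T : Matrix κ κ ℂ) (n : ι → Matrix κ κ ℂ) (U : ℝ) :
    Module.End ℂ (Matrix κ κ ℂ) :=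
  LinearMap.mulLeft ℂ T + LinearMap.mulRight ℂ T -
    (U : ℂ) • ∑ x, LinearMap.mulLeft ℂ (n x) * LinearMap.mulRight ℂ (n x)

variable {T : Matrix κ κ ℂ} {n : ι → Matrix κ κ ℂ} {U E : ℝ}

theorem reflectionHam_apply (V : Matrix κ κ ℂ) :
    reflectionHam T n U V = T * V + V * T - (U : ℂ) • ∑ x, n x * (V * n x) := by
  simp [reflectionHam, LinearMap.sum_apply]

theorem trace_mul_reflectionHam_comm (V W : Matrix κ κ ℂ) :
    (V * reflectionHam T n U W).trace = (W * reflectionHam T n U V).trace := by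
  simp only [reflectionHam_apply, mul_add, mul_sub, Matrix.mul_smul, Finset.mul_sum, trace_add,
    trace_sub, trace_smul, trace_sum]
  have h1 : (V * (T * W)).trace = (W * (V * T)).trace := by
    rw [← Matrix.mul_assoc, trace_mul_comm]
  have h2 : (V * (W * T)).trace = (W * (T * V)).trace := by
    rw [← Matrix.mul_assoc W, ← trace_mul_comm V]
  have h3 : ∀ x, (V * (n x * (W * n x))).trace = (W * (n x * (V * n x))).trace := fun x => by
    rw [← Matrix.mul_assoc, ← Matrix.mul_assoc, trace_mul_comm, ← Matrix.mul_assoc,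
      trace_mul_comm]
  rw [h1, h2]
  simp only [h3]
  ring

theorem conjTranspose_reflectionHam (hT : T.IsHermitian) (hn : ∀ x, (n x).IsHermitian)
    (V : Matrix κ κ ℂ) :
    (reflectionHam T n U V)ᴴ = reflectionHam T n U Vᴴ := by
  simp only [reflectionHam_apply, conjTranspose_sub, conjTranspose_add, conjTranspose_mul,
    conjTranspose_smul, conjTranspose_sum, hT.eq, (hn _).eq, Matrix.mul_assoc]
  simp [add_comm]

/-- A state whose energy is the lowest one is an eigenstate. -/
theorem reflectionHam_eq_of_trace_le (hT : T.IsHermitian) (hn : ∀ x, (n x).IsHermitian)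
    (hE : ∀ V : Matrix κ κ ℂ, V.IsHermitian →
      E * (V * V).trace.re ≤ (V * reflectionHam T n U V).trace.re)
    {R : Matrix κ κ ℂ} (hR : R.IsHermitian)
    (hle : (R * reflectionHam T n U R).trace.re ≤ E * (R * R).trace.re) :
    reflectionHam T n U R = (E : ℂ) • R := by
  set h := reflectionHam T n U with hh
  set W := h R - (E : ℂ) • R with hW
  have hWh : W.IsHermitian := by
    simp only [IsHermitian, hW, conjTranspose_sub, conjTranspose_smul, hR.eq, hh,
      conjTranspose_reflectionHam hT hn]
    simp
  -- The residual `W = (h - E) R` is used as a direction of descent: the variational bound at `R - s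
  -- W` is a quadratic inequality in `s` without constant term, and its linear coefficient is `-2 tr
  -- W²`.
  have hq : ∀ s : ℝ, 0 ≤ -2 * s * (W * W).trace.re +
      s ^ 2 * ((W * h W).trace.re - E * (W * W).trace.re) := by
    intro s
    have h1 := hE (R - (s : ℂ) • W) (hR.sub (by simp [IsHermitian, hWh.eq]))
    have h2 : ((R - (s : ℂ) • W) * h (R - (s : ℂ) • W)).trace
        = (R * h R).trace - 2 * s * (W * h R).trace + s ^ 2 * (W * h W).trace := by
      simp only [map_sub, map_smul, mul_sub, sub_mul, trace_sub, Matrix.mul_smul, Matrix.smul_mul,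
        trace_smul, smul_eq_mul, hh, trace_mul_reflectionHam_comm R W]
      ring
    have h3 : ((R - (s : ℂ) • W) * (R - (s : ℂ) • W)).trace
        = (R * R).trace - 2 * s * (W * R).trace + s ^ 2 * (W * W).trace := by
      simp only [mul_sub, sub_mul, trace_sub, Matrix.mul_smul, Matrix.smul_mul, trace_smul,
        smul_eq_mul, trace_mul_comm R W]
      ring
    have h4 : (W * h R).trace = (W * W).trace + E * (W * R).trace := by
      conv_rhs => rw [hW]
      simp only [mul_sub, trace_sub, Matrix.mul_smul, trace_smul, smul_eq_mul]
      rw [← hW]; ring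
    rw [h2, h3, h4] at h1
    have e1 : ∀ z : ℂ, (2 * (s : ℂ) * z).re = 2 * s * z.re := fun z => by
      rw [show (2 * (s : ℂ) * z) = ((2 * s : ℝ) : ℂ) * z by push_cast; ring, Complex.re_ofReal_mul]
    have e2 : ∀ z : ℂ, ((s : ℂ) ^ 2 * z).re = s ^ 2 * z.re := fun z => by
      rw [← Complex.ofReal_pow, Complex.re_ofReal_mul]
    simp only [Complex.add_re, Complex.sub_re, e1, e2, Complex.re_ofReal_mul] at h1
    nlinarith [h1, hle]
  have hw0 : 0 ≤ (W * W).trace.re := by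
    have := (posSemidef_conjTranspose_mul_self W).trace_nonneg
    rw [hWh.eq] at this
    exact (Complex.le_def.mp this).1
  have hQ0 := hE W hWh
  have hw : (W * W).trace.re = 0 := by
    by_contra hne
    have hpos : 0 < (W * W).trace.re := lt_of_le_of_ne hw0 (Ne.symm hne)
    set w := (W * W).trace.re
    set q := (W * h W).trace.re - E * w with hqdef
    have hq0 : 0 ≤ q := by rw [hqdef]; linarith
    -- This `s` is small enough for the linear term to dominate; `q + 1` instead of `q` covers `q =
    -- 0`.
    have h5 := hq (w / (q + 1))
    have : w / (q + 1) * (-2 * w + w / (q + 1) * q) < 0 := by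
      apply mul_neg_of_pos_of_neg (by positivity)
      have : w / (q + 1) * q ≤ w := by
        rw [div_mul_eq_mul_div, div_le_iff₀ (by positivity)]; nlinarith
      linarith
    nlinarith
  have hW0 : W = 0 := by
    rw [← Matrix.trace_conjTranspose_mul_self_eq_zero_iff, hWh.eq]
    apply Complex.ext hw
    have := (posSemidef_conjTranspose_mul_self W).trace_nonneg
    rw [hWh.eq] at this
    exact (Complex.le_def.mp this).2.symm
  exact sub_eq_zero.mp hW0

/-- The kernel of a positive semidefinite eigenstate is invariant. -/
theorem mulVec_eq_zero_of_reflectionHam_eq (hU : 0 < U) (hn : ∀ x, (n x).IsHermitian)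
    {R : Matrix κ κ ℂ} (hR : R.PosSemidef) (hRE : reflectionHam T n U R = (E : ℂ) • R)
    {v : κ → ℂ} (hv : R *ᵥ v = 0) : (∀ x, R *ᵥ (n x *ᵥ v) = 0) ∧ R *ᵥ (T *ᵥ v) = 0 := by
  have hvR : star v ᵥ* R = 0 := by
    rw [← hR.isHermitian.eq, ← star_mulVec, hv, star_zero]
  have key := congrArg (fun M => M *ᵥ v) hRE
  simp only [reflectionHam_apply, sub_mulVec, add_mulVec, smul_mulVec, sum_mulVec,
    ← mulVec_mulVec, hv, mulVec_zero, smul_zero, zero_add] at key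
  -- Pairing the eigenvalue equation applied to `v` with `v` itself kills the remaining kinetic
  -- term, because `v† R = 0`. A sum of nonnegative terms is left, so each one vanishes.
  have hsum : ∑ x, star (n x *ᵥ v) ⬝ᵥ (R *ᵥ (n x *ᵥ v)) = 0 := by
    have h1 := congrArg (fun w => star v ⬝ᵥ w) key
    simp only [dotProduct_sub, dotProduct_smul, dotProduct_zero, dotProduct_mulVec (star v) R,
      hvR, zero_dotProduct, zero_sub, neg_eq_zero, smul_eq_mul, mul_eq_zero, dotProduct_sum,
      Complex.ofReal_eq_zero, hU.ne', false_or] at h1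
    rw [← h1]
    refine Finset.sum_congr rfl fun x _ => ?_
    rw [star_mulVec, (hn x).eq, ← dotProduct_mulVec]
  have hnx : ∀ x, R *ᵥ (n x *ᵥ v) = 0 := by
    intro x
    rw [← hR.dotProduct_mulVec_zero_iff]
    exact (Finset.sum_eq_zero_iff_of_nonneg fun x _ => hR.dotProduct_mulVec_nonneg _).mp hsum x
      (Finset.mem_univ x)
  refine ⟨hnx, ?_⟩
  simpa [hnx] using key

/-- Spin reflection positivity: Hermitian ground states are semidefinite. -/
theorem posSemidef_or_of_reflectionHam_eq (hU : 0 < U) (hT : T.IsHermitian)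
    (hn : ∀ x, (n x).IsHermitian)
    (irr : ∀ K : Submodule ℂ (κ → ℂ), (∀ v ∈ K, T *ᵥ v ∈ K) → (∀ x, ∀ v ∈ K, n x *ᵥ v ∈ K) →
      K = ⊥ ∨ K = ⊤)
    (hE : ∀ V : Matrix κ κ ℂ, V.IsHermitian →
      E * (V * V).trace.re ≤ (V * reflectionHam T n U V).trace.re)
    {V : Matrix κ κ ℂ} (hV : V.IsHermitian) (hVE : reflectionHam T n U V = (E : ℂ) • V) :
    V.PosSemidef ∨ (-V).PosSemidef := by
  obtain ⟨A, B, hA, hB, rfl, hAB, hBA⟩ := hV.exists_posSemidef_sub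
  -- Both parts have the same residual because their difference is an eigenstate; so the energy
  -- excess of `A` equals the cross term `tr (A h B)`.
  have hZ : reflectionHam T n U A - (E : ℂ) • A = reflectionHam T n U B - (E : ℂ) • B := by
    rw [map_sub, smul_sub] at hVE
    linear_combination (norm := module) hVE
  have hAhB : (A * reflectionHam T n U B).trace.re ≤ 0 := by
    rw [reflectionHam_apply]
    simp only [mul_add, mul_sub, Matrix.mul_smul, Finset.mul_sum, trace_add, trace_sub,
      trace_smul, trace_sum]
    rw [← Matrix.mul_assoc A B, hAB, trace_mul_comm A (T * B), Matrix.mul_assoc, hBA]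
    simp only [Matrix.mul_zero, Matrix.zero_mul, trace_zero, zero_add, zero_sub, Complex.neg_re,
      smul_eq_mul, Complex.re_ofReal_mul, Complex.re_sum, Left.neg_nonpos_iff]
    refine mul_nonneg hU.le (Finset.sum_nonneg fun x _ => ?_)
    have h1 := hB.mul_mul_conjTranspose_same (n x)
    rw [(hn x).eq, Matrix.mul_assoc] at h1
    exact (Complex.le_def.mp (hA.trace_mul_nonneg h1)).1
  have hAA : reflectionHam T n U A = (E : ℂ) • A := by
    refine reflectionHam_eq_of_trace_le hT hn hE hA.isHermitian ?_
    have h1 := congrArg (fun M => (A * M).trace.re) hZ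
    simp only [mul_sub, Matrix.mul_smul, trace_sub, trace_smul, hAB, smul_zero,
      sub_zero, Complex.sub_re, smul_eq_mul, Complex.re_ofReal_mul] at h1
    linarith
  by_cases hA0 : A = 0
  · right; simpa [hA0] using hB
  left
  -- The kernel of `A` is an invariant subspace, hence trivial as `A ≠ 0`; then `A B = 0` leaves no
  -- room for `B`.
  have hker : ∀ v, A *ᵥ v = 0 → v = 0 := by
    let K : Submodule ℂ (κ → ℂ) := LinearMap.ker A.mulVecLin
    have hK : K = ⊥ ∨ K = ⊤ := by
      refine irr K (fun v hv => ?_) (fun x v hv => ?_)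
      · exact (mulVec_eq_zero_of_reflectionHam_eq hU hn hA hAA hv).2
      · exact (mulVec_eq_zero_of_reflectionHam_eq hU hn hA hAA hv).1 x
    rcases hK with hK | hK
    · intro v hv
      have : v ∈ K := hv
      rwa [hK, Submodule.mem_bot] at this
    · exfalso
      apply hA0
      have h1 : A.mulVecLin = 0 := LinearMap.ker_eq_top.mp hK
      ext i j
      have := congrFun (LinearMap.congr_fun h1 (Pi.single j 1)) i
      simpa using this
  have hB0 : B = 0 := by
    ext i j
    have := hker (B *ᵥ Pi.single j 1) (by rw [mulVec_mulVec, hAB, zero_mulVec])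
    simpa using congrFun this i
  simpa [hB0] using hA

/-- A ground state with vanishing overlap with a positive diagonal state vanishes. -/
theorem eq_zero_of_reflectionHam_eq (hU : 0 < U) (hT : T.IsHermitian)
    (hn : ∀ x, (n x).IsHermitian)
    (irr : ∀ K : Submodule ℂ (κ → ℂ), (∀ v ∈ K, T *ᵥ v ∈ K) → (∀ x, ∀ v ∈ K, n x *ᵥ v ∈ K) →
      K = ⊥ ∨ K = ⊤)
    (hE : ∀ V : Matrix κ κ ℂ, V.IsHermitian →
      E * (V * V).trace.re ≤ (V * reflectionHam T n U V).trace.re)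
    {f : κ → ℝ} (hf : ∀ i, 0 < f i)
    {V : Matrix κ κ ℂ} (hVE : reflectionHam T n U V = (E : ℂ) • V)
    (hV : ∑ i, (f i : ℂ) * V i i = 0) : V = 0 := by
  -- Positive weights force every diagonal entry to vanish, hence the trace, hence the matrix.
  have psd : ∀ R : Matrix κ κ ℂ, R.PosSemidef → ∑ i, f i * (R i i).re = 0 → R = 0 := by
    intro R hR hsum
    have h0 : ∀ i, 0 ≤ R i i := fun i => hR.diag_nonneg
    have h1 := (Finset.sum_eq_zero_iff_of_nonneg fun i _ =>
      mul_nonneg (hf i).le (Complex.le_def.mp (h0 i)).1).mp hsum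
    rw [← hR.trace_eq_zero_iff]
    refine Finset.sum_eq_zero fun i hi => ?_
    have h2 := h1 i hi
    have h3 : (R i i).re = 0 := by simpa [(hf i).ne'] using h2
    exact Complex.ext h3 (Complex.le_def.mp (h0 i)).2.symm
  have herm : ∀ R : Matrix κ κ ℂ, R.IsHermitian → reflectionHam T n U R = (E : ℂ) • R →
      ∑ i, f i * (R i i).re = 0 → R = 0 := by
    intro R hR hRE hsum
    rcases posSemidef_or_of_reflectionHam_eq hU hT hn irr hE hR hRE with h | h
    · exact psd R h hsum
    · exact neg_eq_zero.mp (psd (-R) h (by simp [hsum]))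
  have hVE' : reflectionHam T n U Vᴴ = (E : ℂ) • Vᴴ := by
    rw [← conjTranspose_reflectionHam hT hn, hVE, conjTranspose_smul]; simp
  have hre : ∑ i, f i * (V i i).re = 0 := by
    simpa [Complex.re_sum] using congrArg Complex.re hV
  have him : ∑ i, f i * (V i i).im = 0 := by
    simpa [Complex.im_sum] using congrArg Complex.im hV
  -- The eigenspace is closed under the adjoint and `f` is real, so the Hermitian matrices `V + V†`
  -- and `i (V - V†)` satisfy the same hypotheses as `V`.
  have h1 : V + Vᴴ = 0 := by
    refine herm _ ?_ ?_ ?_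
    · simp [IsHermitian, add_comm]
    · rw [map_add, hVE, hVE', smul_add]
    · simp only [Matrix.add_apply, conjTranspose_apply, Complex.add_re, mul_add,
        Finset.sum_add_distrib]
      simpa using hre
  have h2 : Complex.I • (V - Vᴴ) = 0 := by
    refine herm _ ?_ ?_ ?_
    · simp [IsHermitian, ← smul_neg]
    · rw [map_smul, map_sub, hVE, hVE', ← smul_sub, smul_comm]
    · have : ∀ i, f i * ((Complex.I • (V - Vᴴ)) i i).re = -2 * (f i * (V i i).im) := fun i => by
        simp; ring
      simp only [this, ← Finset.mul_sum, him, mul_zero]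
  have h3 : V - Vᴴ = 0 := (smul_eq_zero.mp h2).resolve_left Complex.I_ne_zero
  have h4 : (2 : ℂ) • V = 0 := by
    rw [two_smul]; linear_combination (norm := module) h1 + h3
  exact (smul_eq_zero.mp h4).resolve_left two_ne_zero

end SpinReflection

/-! ### Fock space as a space of matrices; canonical anticommutation relations -/

section Operators

variable {Λ : Type*} [Fintype Λ] [DecidableEq Λ]

local notation "C" => creationMatrix

/-- The wave function of a state as a matrix indexed by the up-spin and down-spin electrons. -/
def toMat : Fock Λ ≃ₗ[ℂ] Matrix (Finset Λ) (Finset Λ) ℂ where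
  toFun Φ := Matrix.of fun X Y => Φ (X, Y)
  invFun W := WithLp.toLp 2 fun p => W p.1 p.2
  map_add' _ _ := rfl
  map_smul' _ _ := rfl
  left_inv _ := rfl
  right_inv _ := rfl

theorem toMat_apply (Φ : Fock Λ) (X Y : Finset Λ) : toMat Φ X Y = Φ (X, Y) := rfl

theorem inner_eq_trace (Φ Ψ : Fock Λ) :
    inner ℂ Φ Ψ = ((toMat Φ).conjTranspose * toMat Ψ).trace := by
  simp only [PiLp.inner_apply, Matrix.trace, Matrix.diag, Matrix.mul_apply,
    Matrix.conjTranspose_apply, toMat_apply, Fintype.sum_prod_type]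
  rw [Finset.sum_comm]
  simp [mul_comm]

/-- The parity of the number of particles. -/
def parity (Λ : Type*) [Fintype Λ] [DecidableEq Λ] : Matrix (Finset Λ) (Finset Λ) ℂ :=
  numDiag fun n => (-1) ^ n

local notation "P" => parity

theorem parity_mul_self : P Λ * P Λ = 1 := by
  simp [parity, numDiag, Matrix.diagonal_mul_diagonal, ← mul_pow]

theorem parity_mul_creationMatrix (x : Λ) : P Λ * C x = -(C x * P Λ) := by
  rw [parity, numDiag_mul_creationMatrix, ← Matrix.mul_neg]
  congr 1
  simp [numDiag, pow_succ]

theorem transpose_creationMatrix_mul_parity (x : Λ) :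
    (C x).transpose * P Λ = -(P Λ * (C x).transpose) := by
  have := congrArg Matrix.transpose (parity_mul_creationMatrix x)
  simpa [Matrix.transpose_mul, parity, transpose_numDiag] using this

theorem conjTranspose_parity : (P Λ).conjTranspose = P Λ := by
  simp [parity, numDiag, Matrix.diagonal_conjTranspose]

theorem toMat_occ (X Y : Finset Λ) : toMat (occ X Y) = Matrix.single X Y 1 := by
  ext X' Y'
  simp only [toMat_apply, occ, PiLp.single_apply, Matrix.single_apply, Prod.mk.injEq,
    eq_comm]

theorem toMat_create_up (x : Λ) (Φ : Fock Λ) : toMat (create x 0 Φ) = C x * toMat Φ := by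
  have : toMat.toLinearMap ∘ₗ create x 0 =
      LinearMap.mulLeft ℂ (C x) ∘ₗ toMat.toLinearMap := by
    apply (EuclideanSpace.basisFun (Finset Λ × Finset Λ) ℂ).toBasis.ext
    rintro ⟨X, Y⟩
    have h1 : (EuclideanSpace.basisFun (Finset Λ × Finset Λ) ℂ).toBasis (X, Y) = occ X Y := by
      simp [occ]
    simp only [LinearMap.comp_apply]
    rw [h1]
    conv_lhs => rw [create, ← h1, Module.Basis.constr_basis]
    simp only [LinearEquiv.coe_coe, toMat_occ, LinearMap.mulLeft_apply]
    ext X' Y'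
    rw [creationMatrix_mul_apply]
    by_cases hx : x ∈ X
    · by_cases hx' : x ∈ X'
      · have : X ≠ X'.erase x := fun h => by simp [h] at hx
        simp [hx, hx', this]
      · simp [hx, hx']
    · by_cases hx' : x ∈ X'
      · by_cases hX : X = X'.erase x
        · subst hX
          simp [hx', toMat_occ, Matrix.single_apply, fsign_erase, orderSign_self]
        · have : insert x X ≠ X' := fun h => hX (by rw [← h, Finset.erase_insert hx])
          simp [hx, hx', toMat_occ, this, hX]
      · have : insert x X ≠ X' := fun h => hx' (by simp [← h])
        simp [hx, hx', toMat_occ, this]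
  exact LinearMap.congr_fun this Φ

/-- Left and right multiplications commute; the parity factor, which carries the sign `(-1) ^ |X|`
of the up modes, is what makes operators of opposite spin anticommute. -/
theorem toMat_create_down (x : Λ) (Φ : Fock Λ) :
    toMat (create x 1 Φ) = P Λ * toMat Φ * (C x).transpose := by
  have : toMat.toLinearMap ∘ₗ create x 1 =
      LinearMap.mulLeft ℂ (P Λ) ∘ₗ LinearMap.mulRight ℂ (C x).transpose ∘ₗ toMat.toLinearMap := by
    apply (EuclideanSpace.basisFun (Finset Λ × Finset Λ) ℂ).toBasis.ext
    rintro ⟨X, Y⟩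
    have h1 : (EuclideanSpace.basisFun (Finset Λ × Finset Λ) ℂ).toBasis (X, Y) = occ X Y := by
      simp [occ]
    simp only [LinearMap.comp_apply]
    rw [h1]
    conv_lhs => rw [create, ← h1, Module.Basis.constr_basis]
    simp only [LinearEquiv.coe_coe, toMat_occ, LinearMap.mulLeft_apply, LinearMap.mulRight_apply]
    ext X' Y'
    rw [parity, numDiag, Matrix.diagonal_mul,
      ← Matrix.transpose_apply (Matrix.single X Y 1 * (C x).transpose), Matrix.transpose_mul,
      Matrix.transpose_transpose, creationMatrix_mul_apply, Matrix.transpose_apply]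
    by_cases hx : x ∈ Y
    · by_cases hx' : x ∈ Y'
      · have : Y ≠ Y'.erase x := fun h => by simp [h] at hx
        simp [hx, hx', this]
      · simp [hx, hx']
    · by_cases hx' : x ∈ Y'
      · by_cases hX : Y = Y'.erase x
        · subst hX
          by_cases hXX : X = X'
          · subst hXX
            simp [hx', toMat_occ, fsign_erase, orderSign_self]
          · simp [hx', toMat_occ, hXX]
        · have : insert x Y ≠ Y' := fun h => hX (by rw [← h, Finset.erase_insert hx])
          simp [hx, hx', toMat_occ, this, hX]
      · have : insert x Y ≠ Y' := fun h => hx' (by simp [← h])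
        simp [hx, hx', toMat_occ, this]
  rw [Matrix.mul_assoc]
  exact LinearMap.congr_fun this Φ

/-- Annihilation is given only as an adjoint, so the candidate is checked against the trace inner
product. -/
theorem toMat_annihilate_up (x : Λ) (Φ : Fock Λ) :
    toMat (annihilate x 0 Φ) = (C x).transpose * toMat Φ := by
  have : annihilate x 0 = toMat.symm.toLinearMap ∘ₗ LinearMap.mulLeft ℂ (C x).transpose ∘ₗ
      toMat.toLinearMap := by
    symm
    rw [annihilate, LinearMap.eq_adjoint_iff]
    intro Φ Ψ
    simp only [inner_eq_trace, LinearMap.comp_apply, LinearEquiv.coe_coe,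
      LinearEquiv.apply_symm_apply, LinearMap.mulLeft_apply, toMat_create_up,
      Matrix.conjTranspose_mul, conjTranspose_transpose_creationMatrix, Matrix.mul_assoc]
  rw [this]
  simp

theorem toMat_annihilate_down (x : Λ) (Φ : Fock Λ) :
    toMat (annihilate x 1 Φ) = P Λ * toMat Φ * C x := by
  have : annihilate x 1 = toMat.symm.toLinearMap ∘ₗ LinearMap.mulLeft ℂ (P Λ) ∘ₗ
      LinearMap.mulRight ℂ (C x) ∘ₗ toMat.toLinearMap := by
    symm
    rw [annihilate, LinearMap.eq_adjoint_iff]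
    intro Φ Ψ
    simp only [inner_eq_trace, LinearMap.comp_apply, LinearEquiv.coe_coe,
      LinearEquiv.apply_symm_apply, LinearMap.mulLeft_apply, LinearMap.mulRight_apply,
      toMat_create_down, Matrix.conjTranspose_mul, conjTranspose_creationMatrix,
      conjTranspose_parity]
    rw [← Matrix.mul_assoc, Matrix.trace_mul_comm _ (C x).transpose]
    simp only [Matrix.mul_assoc]
  rw [this]
  simp [Matrix.mul_assoc]

theorem end_ext {A B : Module.End ℂ (Fock Λ)} (h : ∀ Φ, toMat (A Φ) = toMat (B Φ)) : A = B :=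
  LinearMap.ext fun Φ => toMat.injective (h Φ)

theorem create_anticomm (x y : Λ) (σ τ : Spin) :
    create x σ * create y τ + create y τ * create x σ = 0 := by
  have hC := creationMatrix_anticomm x y
  have hCt := congrArg Matrix.transpose (creationMatrix_anticomm y x)
  simp only [Matrix.transpose_add, Matrix.transpose_mul, Matrix.transpose_zero] at hCt
  have key : ∀ x y : Λ, create x 0 * create y 1 + create y 1 * create x 0 = 0 := by
    intro x y
    apply end_ext; intro Φ
    simp only [LinearMap.add_apply, Module.End.mul_apply, map_add, toMat_create_up,
      toMat_create_down, LinearMap.zero_apply, map_zero]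
    have := parity_mul_creationMatrix x
    rw [← Matrix.mul_assoc (P Λ), this]
    simp [Matrix.mul_assoc]
  fin_cases σ <;> fin_cases τ
  · apply end_ext; intro Φ
    simp only [Fin.zero_eta, Fin.isValue, LinearMap.add_apply, Module.End.mul_apply, map_add,
      toMat_create_up,
      ← Matrix.mul_assoc, ← Matrix.add_mul, hC]
    simp
  · exact key x y
  · rw [add_comm]; exact key y x
  · apply end_ext; intro Φ
    simp only [Fin.mk_one, Fin.isValue, LinearMap.add_apply, Module.End.mul_apply, map_add,
      toMat_create_down,
      ← Matrix.mul_assoc, parity_mul_self]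
    simp only [Matrix.one_mul, Matrix.mul_assoc, ← Matrix.mul_add]
    rw [add_comm, hCt]
    simp

theorem annihilate_create_anticomm (x y : Λ) (σ τ : Spin) :
    annihilate x σ * create y τ + create y τ * annihilate x σ =
      if x = y ∧ σ = τ then 1 else 0 := by
  fin_cases σ <;> fin_cases τ
  · apply end_ext; intro Φ
    have hC := transpose_creationMatrix_anticomm x y
    simp only [Fin.zero_eta, Fin.isValue, LinearMap.add_apply, Module.End.mul_apply, map_add,
      toMat_create_up, toMat_annihilate_up,
      ← Matrix.mul_assoc, ← Matrix.add_mul, hC]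
    split_ifs <;> simp_all
  · apply end_ext; intro Φ
    have := transpose_creationMatrix_mul_parity x
    simp only [Fin.zero_eta, Fin.mk_one, Fin.isValue, LinearMap.add_apply, Module.End.mul_apply, map_add,
      toMat_create_down, toMat_annihilate_up]
    rw [← Matrix.mul_assoc, ← Matrix.mul_assoc, this]
    simp [Matrix.mul_assoc]
  · apply end_ext; intro Φ
    have := parity_mul_creationMatrix y
    simp only [Fin.zero_eta, Fin.mk_one, Fin.isValue, LinearMap.add_apply, Module.End.mul_apply, map_add,
      toMat_create_up, toMat_annihilate_down]
    rw [← Matrix.mul_assoc, this]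
    simp [Matrix.mul_assoc]
  · apply end_ext; intro Φ
    have hC := transpose_creationMatrix_anticomm y x
    simp only [Fin.mk_one, Fin.isValue, LinearMap.add_apply, Module.End.mul_apply, map_add,
      toMat_create_down, toMat_annihilate_down,
      ← Matrix.mul_assoc, parity_mul_self]
    simp only [Matrix.one_mul, Matrix.mul_assoc, ← Matrix.mul_add, hC]
    simp only [eq_comm (a := y)]
    split_ifs <;> simp_all

theorem adjoint_create (x : Λ) (σ : Spin) : LinearMap.adjoint (create x σ) = annihilate x σ := rfl

theorem adjoint_annihilate (x : Λ) (σ : Spin) :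
    LinearMap.adjoint (annihilate x σ) = create x σ := LinearMap.adjoint_adjoint _

theorem annihilate_anticomm (x y : Λ) (σ τ : Spin) :
    annihilate x σ * annihilate y τ + annihilate y τ * annihilate x σ = 0 := by
  have := congrArg LinearMap.adjoint (create_anticomm y x τ σ)
  simpa only [map_add, Module.End.mul_eq_comp, LinearMap.adjoint_comp, adjoint_create, map_zero]
    using this

end Operators

/-! ### Global spin rotations and their commutators with the Hamiltonian -/

section Commutator

variable {R ι : Type*} [Ring R] [Algebra ℂ R]

theorem ring_sum_lie (s : Finset ι) (f : ι → R) (a : R) :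
    ⁅∑ i ∈ s, f i, a⁆ = ∑ i ∈ s, ⁅f i, a⁆ := by
  simp [Ring.lie_def, Finset.sum_mul, Finset.mul_sum]

theorem ring_lie_sum (s : Finset ι) (f : ι → R) (a : R) :
    ⁅a, ∑ i ∈ s, f i⁆ = ∑ i ∈ s, ⁅a, f i⁆ := by
  simp [Ring.lie_def, Finset.sum_mul, Finset.mul_sum]

theorem ring_lie_smul (c : ℂ) (a b : R) : ⁅a, c • b⁆ = c • ⁅a, b⁆ := by
  simp [Ring.lie_def, smul_sub]

theorem ring_lie_mul (a b c : R) : ⁅a, b * c⁆ = ⁅a, b⁆ * c + b * ⁅a, c⁆ := by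
  simp only [Ring.lie_def]; noncomm_ring

theorem ring_lie_add (a b c : R) : ⁅a, b + c⁆ = ⁅a, b⁆ + ⁅a, c⁆ := by
  simp only [Ring.lie_def]; noncomm_ring

end Commutator

section Spin

variable {Λ : Type*} [Fintype Λ] [DecidableEq Λ]

local notation "C" => creationMatrix

/-- The operator that moves an electron from the mode `(y, τ)` to the mode `(x, σ)`. -/
def transfer (x : Λ) (σ : Spin) (y : Λ) (τ : Spin) : Module.End ℂ (Fock Λ) :=
  create x σ * annihilate y τ

theorem lie_transfer (x y z w : Λ) (σ τ μ ν : Spin) :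
    ⁅transfer x σ y τ, transfer z μ w ν⁆ =
      (if y = z ∧ τ = μ then transfer x σ w ν else 0) -
        (if w = x ∧ ν = σ then transfer z μ y τ else 0) := by
  have h1 := annihilate_create_anticomm y z τ μ
  have h2 := annihilate_create_anticomm w x ν σ
  have h3 := create_anticomm x z σ μ
  have h4 := annihilate_anticomm y w τ ν
  have e1 : (if y = z ∧ τ = μ then transfer x σ w ν else 0) =
      create x σ * (if y = z ∧ τ = μ then 1 else 0) * annihilate w ν := by
    split_ifs <;> simp [transfer]
  have e2 : (if w = x ∧ ν = σ then transfer z μ y τ else 0) =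
      create z μ * (if w = x ∧ ν = σ then 1 else 0) * annihilate y τ := by
    split_ifs <;> simp [transfer]
  rw [e1, e2, ← h1, ← h2, Ring.lie_def, transfer, transfer]
  have h5 : create x σ * create z μ = -(create z μ * create x σ) := eq_neg_of_add_eq_zero_left h3
  have h6 : annihilate y τ * annihilate w ν = -(annihilate w ν * annihilate y τ) :=
    eq_neg_of_add_eq_zero_left h4
  -- Exchanging both the creators and the annihilators costs two signs. The quartic parts of the two
  -- products therefore cancel, and only the contractions survive.
  have h7 : create x σ * create z μ * (annihilate y τ * annihilate w ν) =
      create z μ * create x σ * (annihilate w ν * annihilate y τ) := by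
    rw [h5, h6, neg_mul_neg]
  simp only [mul_add, add_mul, mul_assoc] at h7 ⊢
  rw [h7]
  abel

/-- The generators of the spin rotations: `collective σ τ` is the sum over all sites of the
operators `c†_{x,σ} c_{x,τ}`. -/
def collective (Λ : Type*) [Fintype Λ] [DecidableEq Λ] (σ τ : Spin) : Module.End ℂ (Fock Λ) :=
  ∑ x : Λ, transfer x σ x τ

theorem lie_collective_transfer (σ τ : Spin) (x : Λ) (μ : Spin) (y : Λ) (ν : Spin) :
    ⁅collective Λ σ τ, transfer x μ y ν⁆ =
      (if τ = μ then transfer x σ y ν else 0) - (if ν = σ then transfer x μ y τ else 0) := by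
  rw [collective, ring_sum_lie]
  simp only [lie_transfer, Finset.sum_sub_distrib, ite_and, Finset.sum_ite_eq,
    Finset.sum_ite_eq', Finset.mem_univ, if_true]

theorem lie_collective_collective (σ τ μ ν : Spin) :
    ⁅collective Λ σ τ, collective Λ μ ν⁆ =
      (if τ = μ then collective Λ σ ν else 0) - (if ν = σ then collective Λ μ τ else 0) := by
  conv_lhs => rw [collective.eq_def Λ μ ν, ring_lie_sum]
  simp only [lie_collective_transfer, Finset.sum_sub_distrib]
  split_ifs <;> simp [collective]

theorem hopping_eq (t : Matrix Λ Λ ℝ) :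
    hopping t = ∑ x, ∑ y, ∑ σ : Spin, (t x y : ℂ) • transfer x σ y σ := rfl

theorem lie_collective_hopping (t : Matrix Λ Λ ℝ) (σ τ : Spin) :
    ⁅collective Λ σ τ, hopping t⁆ = 0 := by
  rw [hopping_eq]
  simp only [ring_lie_sum, ring_lie_smul, lie_collective_transfer, ← Finset.smul_sum,
    Finset.sum_sub_distrib, Finset.sum_ite_eq, Finset.sum_ite_eq', Finset.mem_univ, if_true,
    sub_self, smul_zero, Finset.sum_const_zero]

/-- Pauli exclusion on one site. By these products the two terms of the commutator of a spin flip
with `n_↑ n_↓` either cancel or vanish. -/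
theorem transfer_mul_transfer_of_ne {x : Λ} {σ τ : Spin} (h : τ ≠ σ) :
    transfer x σ x σ * transfer x σ x τ = transfer x σ x τ ∧
      transfer x σ x σ * transfer x τ x σ = 0 ∧
      transfer x σ x τ * transfer x τ x τ = transfer x σ x τ ∧
      transfer x τ x σ * transfer x τ x τ = 0 := by
  have sq : ∀ μ : Spin, create x μ * create x μ = 0 := fun μ => by
    have h1 := create_anticomm x x μ μ
    rw [← two_smul ℂ] at h1
    exact (smul_eq_zero.mp h1).resolve_left two_ne_zero
  have sq' : ∀ μ : Spin, annihilate x μ * annihilate x μ = 0 := fun μ => by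
    have h1 := annihilate_anticomm x x μ μ
    rw [← two_smul ℂ] at h1
    exact (smul_eq_zero.mp h1).resolve_left two_ne_zero
  have an : ∀ μ : Spin, annihilate x μ * create x μ = 1 - create x μ * annihilate x μ :=
    fun μ => eq_sub_of_add_eq (by simpa using annihilate_create_anticomm x x μ μ)
  have an' : annihilate x σ * create x τ = -(create x τ * annihilate x σ) :=
    eq_neg_of_add_eq_zero_left (by simpa [h.symm] using annihilate_create_anticomm x x σ τ)
  refine ⟨?_, ?_, ?_, ?_⟩ <;> simp only [transfer]
  · rw [mul_assoc, ← mul_assoc (annihilate x σ), an, sub_mul, mul_sub, one_mul, mul_assoc,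
      ← mul_assoc (create x σ) (create x σ), sq]
    simp
  · rw [mul_assoc, ← mul_assoc (annihilate x σ), an', neg_mul, mul_assoc (create x τ), sq']
    simp
  · rw [mul_assoc, ← mul_assoc (annihilate x τ), an, sub_mul, one_mul, mul_assoc, sq']
    simp
  · rw [mul_assoc, ← mul_assoc (annihilate x σ), an', neg_mul, mul_neg, mul_assoc (create x τ),
      ← mul_assoc (create x τ) (create x τ), sq]
    simp

theorem lie_collective_interaction (U : Λ → ℝ) (σ τ : Spin) :
    ⁅collective Λ σ τ, interaction U⁆ = 0 := by
  rw [interaction]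
  simp only [ring_lie_sum, ring_lie_smul]
  refine Finset.sum_eq_zero fun x _ => ?_
  change _ • ⁅_, transfer x 0 x 0 * transfer x 1 x 1⁆ = 0
  rw [ring_lie_mul, lie_collective_transfer, lie_collective_transfer]
  have h := transfer_mul_transfer_of_ne (x := x) (σ := 0) (τ := 1) (by decide)
  fin_cases σ <;> fin_cases τ <;> simp [h]

theorem lie_collective_hamiltonian (t : Matrix Λ Λ ℝ) (U : Λ → ℝ) (σ τ : Spin) :
    ⁅collective Λ σ τ, hamiltonian t U⁆ = 0 := by
  rw [hamiltonian, ring_lie_add, lie_collective_hopping, lie_collective_interaction, add_zero]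

theorem hamiltonian_collective (t : Matrix Λ Λ ℝ) (U : Λ → ℝ) (σ τ : Spin) (Φ : Fock Λ) :
    hamiltonian t U (collective Λ σ τ Φ) = collective Λ σ τ (hamiltonian t U Φ) := by
  have := LinearMap.congr_fun (lie_collective_hamiltonian t U σ τ) Φ
  simp only [Ring.lie_def, LinearMap.sub_apply, Module.End.mul_apply, LinearMap.zero_apply] at this
  exact (sub_eq_zero.mp this).symm

theorem collective_collective (σ τ μ ν : Spin) (Φ : Fock Λ) :
    collective Λ σ τ (collective Λ μ ν Φ) = collective Λ μ ν (collective Λ σ τ Φ) +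
      ((if τ = μ then collective Λ σ ν Φ else 0) - (if ν = σ then collective Λ μ τ Φ else 0)) := by
  have := LinearMap.congr_fun (lie_collective_collective (Λ := Λ) σ τ μ ν) Φ
  simp only [Ring.lie_def, LinearMap.sub_apply, Module.End.mul_apply] at this
  rw [sub_eq_iff_eq_add] at this
  rw [this, add_comm]
  split_ifs <;> simp

theorem adjoint_collective (σ τ : Spin) :
    LinearMap.adjoint (collective Λ σ τ) = collective Λ τ σ := by
  simp only [collective, map_sum, transfer, Module.End.mul_eq_comp, LinearMap.adjoint_comp,
    adjoint_create, adjoint_annihilate]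

theorem inner_collective_left (σ τ : Spin) (Φ Ψ : Fock Λ) :
    inner ℂ (collective Λ σ τ Φ) Ψ = inner ℂ Φ (collective Λ τ σ Ψ) := by
  rw [← adjoint_collective τ σ, LinearMap.adjoint_inner_left]

theorem totalNumber_eq : totalNumber Λ = collective Λ 0 0 + collective Λ 1 1 := by
  simp only [totalNumber, collective, ← Finset.sum_add_distrib]
  rfl

/-- The Casimir operator in the form `S⁻S⁺ + S_z² + S_z`, where `S⁺` is `collective Λ 0 1`. On
states of given `S_z` only `S⁻S⁺` remains to be found. -/
theorem totalSpinSq_apply (Φ : Fock Λ) :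
    totalSpinSq Λ Φ = collective Λ 1 0 (collective Λ 0 1 Φ) +
      (1 / 4 : ℂ) • ((collective Λ 0 0 - collective Λ 1 1) *
        (collective Λ 0 0 - collective Λ 1 1)) Φ +
      (1 / 2 : ℂ) • (collective Λ 0 0 - collective Λ 1 1) Φ := by
  have h0 : totalSpin Λ 0 = (1 / 2 : ℂ) • (collective Λ 0 1 + collective Λ 1 0) := by
    simp only [totalSpin, siteSpin, collective, ← Finset.smul_sum, ← Finset.sum_add_distrib]
    simp [pauli, transfer]
  have h1 : totalSpin Λ 1 = (-Complex.I / 2 : ℂ) • (collective Λ 0 1 - collective Λ 1 0) := by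
    simp only [totalSpin, siteSpin, collective, Finset.smul_sum, ← Finset.sum_sub_distrib]
    refine Finset.sum_congr rfl fun x _ => ?_
    simp only [pauli, transfer, Fin.sum_univ_two]
    simp
    module
  have h1' : totalSpin Λ 1 ^ 2 = (-1 / 4 : ℂ) • (collective Λ 0 1 - collective Λ 1 0) ^ 2 := by
    rw [h1, smul_pow, div_pow, neg_sq, Complex.I_sq]
    norm_num
  have h2 : totalSpin Λ 2 = (1 / 2 : ℂ) • (collective Λ 0 0 - collective Λ 1 1) := by
    simp only [totalSpin, siteSpin, collective, Finset.smul_sum, ← Finset.sum_sub_distrib]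
    simp [pauli, transfer, sub_eq_add_neg]
  have hc := collective_collective (Λ := Λ) 0 1 1 0 Φ
  simp only [if_true] at hc
  rw [totalSpinSq, Fin.sum_univ_three, h0, h1', h2]
  simp only [pow_two, LinearMap.add_apply, LinearMap.sub_apply, LinearMap.smul_apply,
    Module.End.mul_apply, map_add, map_sub, map_smul, smul_add, smul_sub, smul_smul]
  rw [hc]
  module
end Spin

/-! ### The Hamiltonian on matrices and the particle-hole transformation of the down spins -/

section ParticleHole

variable {Λ : Type*} [Fintype Λ] [DecidableEq Λ]

local notation "C" => creationMatrix

theorem toMat_transfer_up (x y : Λ) (Φ : Fock Λ) :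
    toMat (transfer x 0 y 0 Φ) = C x * (C y).transpose * toMat Φ := by
  simp [transfer, toMat_create_up, toMat_annihilate_up, Matrix.mul_assoc]

theorem toMat_transfer_down (x y : Λ) (Φ : Fock Λ) :
    toMat (transfer x 1 y 1 Φ) = toMat Φ * (C y * (C x).transpose) := by
  simp only [transfer, Module.End.mul_apply, toMat_create_down, toMat_annihilate_down,
    ← Matrix.mul_assoc, parity_mul_self, Matrix.one_mul]

/-- The parity factors cancel in bilinears. Down-spin hopping gives the transposed matrix on the
right, which is the same matrix because `t` is symmetric. -/
theorem toMat_hamiltonian {t : Matrix Λ Λ ℝ} (ht : t.IsSymm) (U : ℝ) (Φ : Fock Λ) :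
    toMat (hamiltonian t (fun _ => U) Φ) = hopMatrix t * toMat Φ + toMat Φ * hopMatrix t +
      (U : ℂ) • ∑ x, numberMatrix x * (toMat Φ * numberMatrix x) := by
  have h1 : toMat (hopping t Φ) = hopMatrix t * toMat Φ + toMat Φ * hopMatrix t := by
    conv_rhs => rw [← transpose_hopMatrix ht]
    conv_rhs => lhs; rw [transpose_hopMatrix ht]
    rw [hopping_eq]
    simp only [LinearMap.sum_apply, LinearMap.smul_apply, map_sum, map_smul, Fin.sum_univ_two,
      toMat_transfer_up, toMat_transfer_down, hopMatrix, Matrix.transpose_sum,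
      Matrix.transpose_smul, Matrix.transpose_mul, Matrix.transpose_transpose, Finset.sum_mul,
      Finset.mul_sum, Matrix.smul_mul, Matrix.mul_smul, LinearMap.add_apply, map_add,
      Finset.sum_add_distrib]
  have h2 : toMat (interaction (fun _ => U) Φ) =
      (U : ℂ) • ∑ x, numberMatrix x * (toMat Φ * numberMatrix x) := by
    rw [interaction, ← Finset.smul_sum]
    simp only [LinearMap.smul_apply, map_smul, LinearMap.sum_apply, map_sum]
    congr 1
    refine Finset.sum_congr rfl fun x _ => ?_
    change toMat (transfer x 0 x 0 (transfer x 1 x 1 Φ)) = _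
    rw [toMat_transfer_up, toMat_transfer_down, creationMatrix_mul_transpose]
  rw [hamiltonian, LinearMap.add_apply, map_add, h1, h2]

theorem conjTranspose_numberMatrix (x : Λ) :
    (numberMatrix x).conjTranspose = numberMatrix x := by
  rw [numberMatrix, Matrix.diagonal_conjTranspose]
  congr 1; ext X; simp only [Pi.star_apply]; split_ifs <;> simp

theorem isSymmetric_hamiltonian {t : Matrix Λ Λ ℝ} (ht : t.IsSymm) (U : ℝ) :
    (hamiltonian t fun _ => U).IsSymmetric := by
  intro Φ Ψ
  simp only [inner_eq_trace, toMat_hamiltonian ht, Matrix.conjTranspose_add,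
    Matrix.conjTranspose_mul, Matrix.conjTranspose_smul, Matrix.conjTranspose_sum,
    conjTranspose_hopMatrix ht, conjTranspose_numberMatrix, Matrix.add_mul, Matrix.mul_add,
    Matrix.trace_add, Matrix.smul_mul, Matrix.mul_smul, Matrix.trace_smul, Finset.sum_mul,
    Finset.mul_sum, Matrix.trace_sum]
  congr 1
  · congr 1
    · rw [Matrix.mul_assoc]
    · rw [Matrix.mul_assoc, Matrix.trace_mul_comm, Matrix.mul_assoc]
  · have hx : ∀ x : Λ, (numberMatrix x * (toMat Φ).conjTranspose * numberMatrix x *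
        toMat Ψ).trace = ((toMat Φ).conjTranspose *
          (numberMatrix x * (toMat Ψ * numberMatrix x))).trace := fun x => by
      rw [Matrix.mul_assoc, Matrix.mul_assoc, Matrix.trace_mul_comm]
      simp only [Matrix.mul_assoc]
    simp only [hx, RCLike.star_def, Complex.conj_ofReal]

theorem sum_numberMatrix : ∑ x : Λ, numberMatrix x = numDiag fun n => (n : ℂ) := by
  ext X Y
  rw [Matrix.sum_apply]
  simp only [numberMatrix, numDiag, Matrix.diagonal_apply]
  by_cases h : X = Y <;> simp [h]

theorem collective_up_apply (Φ : Fock Λ) (X Y : Finset Λ) :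
    collective Λ 0 0 Φ (X, Y) = X.card * Φ (X, Y) := by
  have : toMat (collective Λ 0 0 Φ) = (numDiag fun n => (n : ℂ)) * toMat Φ := by
    simp only [collective, LinearMap.sum_apply, map_sum, toMat_transfer_up,
      creationMatrix_mul_transpose, ← Finset.sum_mul, sum_numberMatrix]
  simpa [numDiag, toMat_apply] using congrFun (congrFun this X) Y

theorem collective_down_apply (Φ : Fock Λ) (X Y : Finset Λ) :
    collective Λ 1 1 Φ (X, Y) = Y.card * Φ (X, Y) := by
  have : toMat (collective Λ 1 1 Φ) = toMat Φ * (numDiag fun n => (n : ℂ)) := by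
    simp only [collective, LinearMap.sum_apply, map_sum, toMat_transfer_down,
      creationMatrix_mul_transpose, ← Finset.mul_sum, sum_numberMatrix]
  simpa [numDiag, toMat_apply, mul_comm] using congrFun (congrFun this X) Y

/-- The sign that distinguishes the two sublattices. -/
def sublatticeSign (A : Finset Λ) (x : Λ) : ℂ := if x ∈ A then 1 else -1

/-- The sign of the particle-hole transformation on the configuration `Z`. -/
def holeSign (A Z : Finset Λ) : ℂ :=
  ∏ x ∈ Z, sublatticeSign A x * fsign x Finset.univ

/-- The matrix of the particle-hole transformation of the down-spin electrons. -/
def holeMatrix (A : Finset Λ) : Matrix (Finset Λ) (Finset Λ) ℂ :=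
  Matrix.of fun Y Z => if Y = Zᶜ then holeSign A Z else 0

theorem sublatticeSign_mul_self (A : Finset Λ) (x : Λ) :
    sublatticeSign A x * sublatticeSign A x = 1 := by
  unfold sublatticeSign; split_ifs <;> simp

theorem star_sublatticeSign (A : Finset Λ) (x : Λ) :
    star (sublatticeSign A x) = sublatticeSign A x := by
  unfold sublatticeSign; split_ifs <;> simp

theorem holeSign_mul_self (A Z : Finset Λ) : holeSign A Z * holeSign A Z = 1 := by
  rw [holeSign, ← Finset.prod_mul_distrib]
  refine Finset.prod_eq_one fun x _ => ?_
  linear_combination (fsign x Finset.univ * fsign x Finset.univ) * sublatticeSign_mul_self A x +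
    fsign_mul_self x Finset.univ

theorem star_holeSign (A Z : Finset Λ) : star (holeSign A Z) = holeSign A Z := by
  rw [holeSign, star_prod]
  refine Finset.prod_congr rfl fun x _ => ?_
  rw [star_mul', star_sublatticeSign, star_fsign]

theorem mul_holeMatrix_apply {κ : Type*} (A : Finset Λ) (M : Matrix κ (Finset Λ) ℂ) (i : κ)
    (Z : Finset Λ) : (M * holeMatrix A) i Z = M i Zᶜ * holeSign A Z := by
  rw [Matrix.mul_apply, Finset.sum_eq_single Zᶜ]
  · simp [holeMatrix]
  · intro Y _ hY; simp [holeMatrix, hY]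
  · simp

theorem mul_transpose_holeMatrix_apply {κ : Type*} (A : Finset Λ) (M : Matrix κ (Finset Λ) ℂ)
    (i : κ) (Y : Finset Λ) :
    (M * (holeMatrix A).transpose) i Y = M i Yᶜ * holeSign A Yᶜ := by
  rw [Matrix.mul_apply, Finset.sum_eq_single Yᶜ]
  · simp [holeMatrix]
  · intro Z _ hZ
    have : Y ≠ Zᶜ := fun h => hZ (by simp [h])
    simp [holeMatrix, this]
  · simp

theorem holeMatrix_mul_transpose (A : Finset Λ) :
    holeMatrix A * (holeMatrix A).transpose = 1 := by
  ext Y Y'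
  rw [mul_transpose_holeMatrix_apply, holeMatrix, Matrix.of_apply, compl_compl, Matrix.one_apply]
  split_ifs
  · exact holeSign_mul_self _ _
  · simp

theorem transpose_holeMatrix_mul (A : Finset Λ) :
    (holeMatrix A).transpose * holeMatrix A = 1 :=
  mul_eq_one_comm.mp (holeMatrix_mul_transpose A)

/-- Complementing a configuration exchanges creation and annihilation. The predecessors of `x` in
`X` and in its complement together are all predecessors of `x`, so the fermionic signs differ by
`fsign x univ`; the same factor in `holeSign` absorbs this. -/
theorem creationMatrix_mul_holeMatrix (A : Finset Λ) (x : Λ) :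
    C x * holeMatrix A = sublatticeSign A x • (holeMatrix A * (C x).transpose) := by
  have hr : ∀ X : Finset Λ, fsign x Finset.univ = fsign x X * fsign x Xᶜ := fun X => by
    rw [← fsign_union x disjoint_compl_right, Finset.union_compl]
  have hM : ∀ M : Matrix (Finset Λ) (Finset Λ) ℂ, ∀ X Z,
      (holeMatrix A * M) X Z = holeSign A Xᶜ * M Xᶜ Z := by
    intro M X Z
    rw [← Matrix.transpose_apply (holeMatrix A * M), Matrix.transpose_mul,
      mul_transpose_holeMatrix_apply, Matrix.transpose_apply, mul_comm]
  ext X Z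
  rw [Matrix.smul_apply, hM, creationMatrix_mul_apply, holeMatrix, Matrix.of_apply]
  simp only [creationMatrix, Matrix.of_apply, Matrix.transpose_apply, Finset.mem_compl, not_not,
    smul_eq_mul]
  by_cases hx : x ∈ X
  · have hiff : X.erase x = Zᶜ ↔ Z = insert x Xᶜ := by
      rw [← Finset.compl_erase, eq_compl_comm, eq_comm]
    by_cases hZ : Z = insert x Xᶜ
    · rw [if_pos hx, if_pos (hiff.mpr hZ), if_pos ⟨hx, hZ⟩, hZ, holeSign,
        Finset.prod_insert (by simpa using hx), ← holeSign, hr X]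
      linear_combination (sublatticeSign A x * holeSign A Xᶜ * fsign x Xᶜ) * fsign_mul_self x X
    · rw [if_pos hx, if_neg (hiff.not.mpr hZ), if_neg (by tauto)]
      simp
  · simp [hx]

theorem transpose_holeMatrix_mul_creationMatrix (A : Finset Λ) (x : Λ) :
    (holeMatrix A).transpose * C x =
      sublatticeSign A x • ((C x).transpose * (holeMatrix A).transpose) := by
  have h := congrArg (fun M => (holeMatrix A).transpose * M * (holeMatrix A).transpose)
    (creationMatrix_mul_holeMatrix A x)
  simp only [Matrix.mul_smul, Matrix.smul_mul] at h
  rw [Matrix.mul_assoc, Matrix.mul_assoc (C x), holeMatrix_mul_transpose, Matrix.mul_one,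
    ← Matrix.mul_assoc, transpose_holeMatrix_mul, Matrix.one_mul] at h
  exact h

theorem transpose_creationMatrix_mul_holeMatrix (A : Finset Λ) (x : Λ) :
    (C x).transpose * holeMatrix A = sublatticeSign A x • (holeMatrix A * C x) := by
  simpa [Matrix.transpose_mul] using
    congrArg Matrix.transpose (transpose_holeMatrix_mul_creationMatrix A x)

theorem transpose_holeMatrix_mul_transpose_creationMatrix (A : Finset Λ) (x : Λ) :
    (holeMatrix A).transpose * (C x).transpose =
      sublatticeSign A x • (C x * (holeMatrix A).transpose) := by
  simpa [Matrix.transpose_mul] using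
    congrArg Matrix.transpose (creationMatrix_mul_holeMatrix A x)

theorem IsBipartite.sublatticeSign_mul {t : Matrix Λ Λ ℝ} {A B : Finset Λ}
    (h : IsBipartite t A B) {x y : Λ} (hxy : t x y ≠ 0) :
    sublatticeSign A x * sublatticeSign A y = -1 := by
  have hB : ∀ z, z ∉ A → z ∈ B := fun z hz => by
    have : z ∈ A ∪ B := by simp [h.union_eq]
    exact (Finset.mem_union.mp this).resolve_left hz
  unfold sublatticeSign
  by_cases hx : x ∈ A <;> by_cases hy : y ∈ A
  · exact absurd (h.left x hx y hy) hxy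
  · simp [hx, hy]
  · simp [hx, hy]
  · exact absurd (h.right x (hB x hx) y (hB y hy)) hxy

/-- Two minus signs cancel on each bond: one from reordering `c_x c†_y`, one from the opposite
sublattice signs of `x` and `y`. -/
theorem hopMatrix_mul_holeMatrix {t : Matrix Λ Λ ℝ} {A B : Finset Λ} (ht : t.IsSymm)
    (h : IsBipartite t A B) : hopMatrix t * holeMatrix A = holeMatrix A * hopMatrix t := by
  conv_rhs => rw [← transpose_hopMatrix ht]
  unfold hopMatrix
  simp only [Matrix.transpose_sum, Matrix.transpose_smul, Matrix.transpose_mul,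
    Matrix.transpose_transpose, Finset.sum_mul, Finset.mul_sum, Matrix.smul_mul, Matrix.mul_smul]
  refine Finset.sum_congr rfl fun x _ => Finset.sum_congr rfl fun y _ => ?_
  by_cases hxy : t x y = 0
  · simp [hxy]
  have hs := h.sublatticeSign_mul hxy
  have hne : x ≠ y := by
    rintro rfl
    rw [sublatticeSign_mul_self] at hs
    norm_num at hs
  have hanti : (C x).transpose * C y = -(C y * (C x).transpose) :=
    eq_neg_of_add_eq_zero_left (by simpa [hne] using transpose_creationMatrix_anticomm x y)
  rw [Matrix.mul_assoc, transpose_creationMatrix_mul_holeMatrix, Matrix.mul_smul,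
    ← Matrix.mul_assoc, creationMatrix_mul_holeMatrix, Matrix.smul_mul,
    smul_smul (sublatticeSign A y), mul_comm (sublatticeSign A y), hs, Matrix.mul_assoc, hanti]
  simp

/-- A particle is the absence of a hole; this is where repulsion becomes attraction. -/
theorem numberMatrix_mul_holeMatrix (A : Finset Λ) (x : Λ) :
    numberMatrix x * holeMatrix A = holeMatrix A * (1 - numberMatrix x) := by
  rw [numberMatrix, ← Matrix.diagonal_one, Matrix.diagonal_sub]
  ext X Z
  rw [Matrix.diagonal_mul, Matrix.mul_diagonal, holeMatrix, Matrix.of_apply]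
  by_cases h : X = Zᶜ
  · subst h
    by_cases hx : x ∈ Z <;> simp [hx]
  · simp [h]

end ParticleHole

/-! ### Irreducibility of hopping and occupation numbers on a connected lattice -/

section Hop

variable {Λ : Type*} [Fintype Λ] [DecidableEq Λ]

local notation "C" => creationMatrix

theorem hopMatrix_apply_insert (t : Matrix Λ Λ ℝ) {x y : Λ} {Z : Finset Λ} (hx : x ∉ Z)
    (hy : y ∉ Z) (hxy : x ≠ y) :
    hopMatrix t (insert x Z) (insert y Z) = t x y * (fsign x Z * fsign y Z) := by
  have entry : ∀ u w : Λ, (C u * (C w).transpose) (insert x Z) (insert y Z) =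
      if u = x ∧ w = y then fsign x Z * fsign y Z else 0 := by
    intro u w
    rw [creationMatrix_mul_apply, Matrix.transpose_apply, creationMatrix, Matrix.of_apply]
    by_cases hu : u = x
    · subst hu
      rw [if_pos (Finset.mem_insert_self _ _), Finset.erase_insert hx,
        fsign_insert u hx, orderSign_self, one_mul]
      by_cases hw : w = y
      · subst hw; simp [hy]
      · have : ¬ (w ∉ Z ∧ insert y Z = insert w Z) := by
          rintro ⟨h1, h2⟩
          have h3 : w ∈ insert y Z := by rw [h2]; simp
          rcases Finset.mem_insert.mp h3 with h | h
          · exact hw h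
          · exact h1 h
        simp [this, hw]
    · rw [if_neg (fun h : u = x ∧ w = y => hu h.1)]
      split_ifs with h1 h2
      · exfalso
        have h3 : x ∈ insert y Z := by
          rw [h2.2]
          exact Finset.mem_insert_of_mem
            (Finset.mem_erase.mpr ⟨Ne.symm hu, Finset.mem_insert_self _ _⟩)
        rcases Finset.mem_insert.mp h3 with h | h
        · exact hxy h
        · exact hx h
      · simp
      · rfl
  simp only [hopMatrix, Matrix.sum_apply, Matrix.smul_apply, entry, ite_and, smul_eq_mul]
  simp

theorem hopMatrix_apply_of_card_ne (t : Matrix Λ Λ ℝ) {X Y : Finset Λ} (h : X.card ≠ Y.card) :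
    hopMatrix t X Y = 0 := by
  have := congrFun (congrFun (numDiag_mul_hopMatrix (fun n => if n = X.card then 1 else 0) t) X) Y
  simpa [numDiag, Ne.symm h] using this

/-- A property of configurations that is preserved when one particle hops to an empty
neighbouring site is preserved when one particle moves to any empty site. -/
theorem IsConnected.move {t : Matrix Λ Λ ℝ} (ht : t.IsSymm) {Q : Finset Λ → Prop}
    (hop : ∀ (Z : Finset Λ) (x y : Λ), x ∉ Z → y ∉ Z → x ≠ y → t x y ≠ 0 →
      Q (insert y Z) → Q (insert x Z))
    {x y : Λ} (h : Relation.ReflTransGen (fun u v => t u v ≠ 0) y x) :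
    ∀ Z : Finset Λ, x ∉ Z → y ∉ Z → Q (insert y Z) → Q (insert x Z) := by
  induction h using Relation.ReflTransGen.head_induction_on with
  | refl => exact fun Z _ _ h => h
  | @head y z hyz _ ih =>
    intro Z hx hy hQ
    rw [← ht.apply] at hyz
    by_cases hxy : x = y
    · rwa [hxy]
    by_cases hzy : z = y
    · exact ih Z hx (hzy ▸ hy) (hzy ▸ hQ)
    by_cases hzx : z = x
    · exact hop Z x y hx hy hxy (hzx ▸ hyz) hQ
    -- If the next site `z` on the path is occupied, its particle first travels on to `x`, and then
    -- the particle at `y` steps into `z`. As the particles are identical, the outcome is the same.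
    by_cases hz : z ∈ Z
    · obtain ⟨Z', hz', rfl⟩ : ∃ Z', z ∉ Z' ∧ insert z Z' = Z :=
        ⟨Z.erase z, Finset.notMem_erase z Z, Finset.insert_erase hz⟩
      have hx' : x ∉ Z' := fun h => hx (Finset.mem_insert_of_mem h)
      have hy' : y ∉ Z' := fun h => hy (Finset.mem_insert_of_mem h)
      rw [Finset.insert_comm] at hQ
      have h1 := ih (insert y Z') (by simp [hxy, hx']) (by simp [hzy, hz']) hQ
      rw [Finset.insert_comm] at h1 ⊢
      exact hop _ z y (by simp [hzx, hz']) (by simp [Ne.symm hxy, hy']) hzy hyz h1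
    · exact ih Z hx hz (hop Z z y hz hy hzy hyz hQ)

/-- Each move of a particle from `X \ Y` to `Y \ X` lowers `|X \ Y|` by one; both differences are
nonempty together because the cardinalities agree. -/
theorem IsConnected.of_hop {t : Matrix Λ Λ ℝ} (hc : IsConnected t) (ht : t.IsSymm)
    {Q : Finset Λ → Prop}
    (hop : ∀ (Z : Finset Λ) (x y : Λ), x ∉ Z → y ∉ Z → x ≠ y → t x y ≠ 0 →
      Q (insert y Z) → Q (insert x Z))
    {X Y : Finset Λ} (hXY : X.card = Y.card) (hQ : Q X) : Q Y := by
  induction hn : (X \ Y).card generalizing X with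
  | zero =>
    have hs : X ⊆ Y := Finset.sdiff_eq_empty_iff_subset.mp (Finset.card_eq_zero.mp hn)
    rwa [← Finset.eq_of_subset_of_card_le hs hXY.ge]
  | succ m ih =>
    obtain ⟨y, hy⟩ : (X \ Y).Nonempty := Finset.card_pos.mp (by omega)
    obtain ⟨x, hx⟩ : (Y \ X).Nonempty := Finset.card_pos.mp (by
      have h1 := Finset.card_sdiff_add_card_inter X Y
      have h2 := Finset.card_sdiff_add_card_inter Y X
      rw [Finset.inter_comm] at h2
      omega)
    rw [Finset.mem_sdiff] at hx hy
    have hx' : x ∉ X.erase y := fun h => hx.2 (Finset.mem_of_mem_erase h)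
    refine ih (X := insert x (X.erase y)) ?_ ?_ ?_
    · rw [Finset.card_insert_of_notMem hx', Finset.card_erase_add_one hy.1, hXY]
    · exact IsConnected.move ht hop (hc y x) _ hx' (Finset.notMem_erase y X)
        (by rwa [Finset.insert_erase hy.1])
    · rw [Finset.insert_sdiff_of_mem _ hx.1, Finset.erase_sdiff_comm,
        Finset.card_erase_of_mem (Finset.mem_sdiff.mpr hy), hn]
      rfl

/-- The configurations of `k` spinless particles. -/
abbrev Config (Λ : Type*) (k : ℕ) := {X : Finset Λ // X.card = k}

/-- The hopping Hamiltonian of `k` spinless fermions. -/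
def hopBlock (t : Matrix Λ Λ ℝ) (k : ℕ) : Matrix (Config Λ k) (Config Λ k) ℂ :=
  (hopMatrix t).submatrix Subtype.val Subtype.val

/-- The occupation numbers in the space of `k` spinless fermions. -/
def numberBlock (k : ℕ) (x : Λ) : Matrix (Config Λ k) (Config Λ k) ℂ :=
  Matrix.diagonal fun X => if x ∈ X.1 then 1 else 0

theorem isHermitian_hopBlock {t : Matrix Λ Λ ℝ} (ht : t.IsSymm) (k : ℕ) :
    (hopBlock t k).IsHermitian := by
  rw [Matrix.IsHermitian, hopBlock, Matrix.conjTranspose_submatrix, conjTranspose_hopMatrix ht]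

theorem isHermitian_numberBlock (k : ℕ) (x : Λ) : (numberBlock k x).IsHermitian := by
  rw [Matrix.IsHermitian, numberBlock, Matrix.diagonal_conjTranspose]
  congr 1; ext X; simp only [Pi.star_apply]; split_ifs <;> simp

/-- Multiplying by `n_x` or `1 - n_x`, according to whether `x` lies in `X`, for every site `x`,
projects `v` onto the single configuration `X`. -/
theorem single_mem_of_invariant {k : ℕ} {K : Submodule ℂ (Config Λ k → ℂ)}
    (hK : ∀ x, ∀ v ∈ K, (numberBlock k x).mulVec v ∈ K) {v : Config Λ k → ℂ} (hv : v ∈ K)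
    {X : Config Λ k} (hX : v X ≠ 0) : Pi.single X 1 ∈ K := by
  have key : ∀ s : Finset Λ,
      (fun Y : Config Λ k => if ∀ x ∈ s, (x ∈ Y.1 ↔ x ∈ X.1) then v Y else 0) ∈ K := by
    intro s
    induction s using Finset.induction_on with
    | empty => simpa using hv
    | insert x s _ ih =>
      by_cases hx : x ∈ X.1
      · convert hK x _ ih using 1
        ext Y
        rw [numberBlock, Matrix.mulVec_diagonal]
        by_cases hY : x ∈ Y.1 <;> simp [hx, hY]
      · convert K.sub_mem ih (hK x _ ih) using 1
        ext Y
        rw [Pi.sub_apply, numberBlock, Matrix.mulVec_diagonal]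
        by_cases hY : x ∈ Y.1 <;> simp [hx, hY]
  have h1 : Pi.single X 1 = (v X)⁻¹ • (fun Y : Config Λ k =>
      if ∀ x ∈ Finset.univ, (x ∈ Y.1 ↔ x ∈ X.1) then v Y else 0) := by
    ext Y
    have : (∀ x ∈ Finset.univ, (x ∈ Y.1 ↔ x ∈ X.1)) ↔ Y = X := by
      rw [Subtype.ext_iff, Finset.ext_iff]; simp
    rw [Pi.smul_apply, Pi.single_apply]
    simp only [this]
    split_ifs with h
    · rw [h, smul_eq_mul, inv_mul_cancel₀ hX]
    · simp
  rw [h1]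
  exact K.smul_mem _ (key _)

/-- The hopping and the occupation numbers act irreducibly on `k` spinless fermions. -/
theorem IsConnected.eq_bot_or_eq_top {t : Matrix Λ Λ ℝ} (hc : IsConnected t) (ht : t.IsSymm)
    {k : ℕ} (K : Submodule ℂ (Config Λ k → ℂ)) (hT : ∀ v ∈ K, (hopBlock t k).mulVec v ∈ K)
    (hn : ∀ x, ∀ v ∈ K, (numberBlock k x).mulVec v ∈ K) : K = ⊥ ∨ K = ⊤ := by
  by_cases hbot : K = ⊥
  · exact Or.inl hbot
  right
  obtain ⟨v, hv, hv0⟩ := K.ne_bot_iff.mp hbot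
  obtain ⟨X₀, hX₀⟩ := Function.ne_iff.mp hv0
  have h0 := single_mem_of_invariant hn hv hX₀
  have hall : ∀ X : Config Λ k, Pi.single X 1 ∈ K := by
    intro X
    let Q : Finset Λ → Prop := fun Y => ∃ h : Y.card = k, Pi.single (⟨Y, h⟩ : Config Λ k) 1 ∈ K
    have hQ : Q X.1 := by
      refine hc.of_hop (Q := Q) ht ?_ (X₀.2.trans X.2.symm) ⟨X₀.2, h0⟩
      rintro Z x y hx hy hxy htxy ⟨hk, hmem⟩
      have hk' : (insert x Z).card = k := by
        rw [← hk, Finset.card_insert_of_notMem hx, Finset.card_insert_of_notMem hy]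
      -- The hopping matrix reaches the new configuration with amplitude `± t x y ≠ 0`, and the
      -- occupation numbers then isolate it.
      refine ⟨hk', single_mem_of_invariant hn (hT _ hmem) ?_⟩
      rw [Matrix.mulVec_single_one, Matrix.col_apply, hopBlock, Matrix.submatrix_apply,
        hopMatrix_apply_insert t hx hy hxy]
      have h1 : fsign x Z ≠ 0 := fun h => by simpa [h] using fsign_mul_self x Z
      have h2 : fsign y Z ≠ 0 := fun h => by simpa [h] using fsign_mul_self y Z
      simp [htxy, h1, h2]
    exact hQ.2
  rw [eq_top_iff]
  intro w _
  rw [pi_eq_sum_univ w]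
  refine K.sum_mem fun X _ => K.smul_mem _ ?_
  convert hall X using 1
  ext Y
  simp [Pi.single_apply, eq_comm]

end Hop

/-! ### Square blocks of `k` up electrons and `k` down holes -/

section Block

variable {Λ : Type*} [Fintype Λ] [DecidableEq Λ]

/-- The wave function of the states with `k` up-spin electrons and `k` down-spin holes. -/
def block (A : Finset Λ) (k : ℕ) : Fock Λ →ₗ[ℂ] Matrix (Config Λ k) (Config Λ k) ℂ where
  toFun Φ := (toMat Φ * holeMatrix A).submatrix Subtype.val Subtype.val
  map_add' Φ Ψ := by rw [map_add, Matrix.add_mul]; rfl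
  map_smul' c Φ := by rw [map_smul, Matrix.smul_mul]; rfl

theorem block_apply (A : Finset Λ) (k : ℕ) (Φ : Fock Λ) (X Z : Config Λ k) :
    block A k Φ X Z = Φ (X.1, Z.1ᶜ) * holeSign A Z.1 :=
  mul_holeMatrix_apply A (toMat Φ) X.1 Z.1

theorem sum_eq_sum_config {M : Type*} [AddCommMonoid M] {k : ℕ} {g : Finset Λ → M}
    (hg : ∀ Y, Y.card ≠ k → g Y = 0) : ∑ Y, g Y = ∑ Y : Config Λ k, g Y.1 := by
  symm
  refine Finset.sum_of_injOn Subtype.val Subtype.val_injective.injOn (by simp [Set.MapsTo])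
    (fun Y _ hY => hg Y fun h => hY ⟨⟨Y, h⟩, by simp, rfl⟩) fun _ _ => rfl

/-- Summing `n_x V (1 - n_x)` over the sites gives `k V - ∑ n_x V n_x`, since a row configuration
has `k` particles; this explains the shift `U k`. -/
theorem block_hamiltonian {t : Matrix Λ Λ ℝ} {A B : Finset Λ} (ht : t.IsSymm)
    (h : IsBipartite t A B) (U : ℝ) (k : ℕ) (Φ : Fock Λ) :
    block A k (hamiltonian t (fun _ => U) Φ) =
      reflectionHam (hopBlock t k) (numberBlock k) U (block A k Φ) +
        ((U * k : ℝ) : ℂ) • block A k Φ := by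
  have h1 : toMat (hamiltonian t (fun _ => U) Φ) * holeMatrix A =
      hopMatrix t * (toMat Φ * holeMatrix A) + toMat Φ * holeMatrix A * hopMatrix t +
        (U : ℂ) • ∑ x, numberMatrix x * (toMat Φ * holeMatrix A * (1 - numberMatrix x)) := by
    rw [toMat_hamiltonian ht]
    simp only [Matrix.add_mul, Matrix.smul_mul, Finset.sum_mul, Matrix.mul_assoc,
      numberMatrix_mul_holeMatrix, hopMatrix_mul_holeMatrix ht h]
  set V := toMat Φ * holeMatrix A with hV
  ext X Z
  change (toMat (hamiltonian t (fun _ => U) Φ) * holeMatrix A) X.1 Z.1 = _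
  rw [h1, reflectionHam_apply]
  simp only [Matrix.add_apply, Matrix.sub_apply, Matrix.smul_apply, Matrix.sum_apply]
  have e1 : (hopMatrix t * V) X.1 Z.1 = (hopBlock t k * block A k Φ) X Z := by
    rw [Matrix.mul_apply, Matrix.mul_apply, sum_eq_sum_config (k := k)]
    · rfl
    · intro Y hY
      rw [hopMatrix_apply_of_card_ne t (by rw [X.2]; exact hY.symm), zero_mul]
  have e2 : (V * hopMatrix t) X.1 Z.1 = (block A k Φ * hopBlock t k) X Z := by
    rw [Matrix.mul_apply, Matrix.mul_apply, sum_eq_sum_config (k := k)]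
    · rfl
    · intro Y hY
      rw [hopMatrix_apply_of_card_ne t (by rw [Z.2]; exact hY), mul_zero]
  have e3 : ∑ x : Λ, (numberMatrix x * (V * (1 - numberMatrix x)) :
      Matrix (Finset Λ) (Finset Λ) ℂ) X.1 Z.1 =
      k * block A k Φ X Z - ∑ x : Λ, (numberBlock k x * (block A k Φ * numberBlock k x) :
        Matrix (Config Λ k) (Config Λ k) ℂ) X Z := by
    have hk : (k : ℂ) = ∑ x : Λ, if x ∈ X.1 then (1 : ℂ) else 0 := by
      simp [X.2]
    rw [hk, Finset.sum_mul, ← Finset.sum_sub_distrib]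
    refine Finset.sum_congr rfl fun x _ => ?_
    rw [numberMatrix, ← Matrix.diagonal_one, Matrix.diagonal_sub, Matrix.diagonal_mul,
      Matrix.mul_diagonal, numberBlock, Matrix.diagonal_mul, Matrix.mul_diagonal]
    change _ * (block A k Φ X Z * _) = _
    ring
  rw [e1, e2, e3]
  simp only [smul_eq_mul]
  push_cast
  ring

/-- The state with a given wave function of `k` up-spin electrons and `k` down-spin holes. -/
def unblock (A : Finset Λ) (k : ℕ) (V : Matrix (Config Λ k) (Config Λ k) ℂ) : Fock Λ :=
  toMat.symm (Matrix.of fun X Y => if h : X.card = k ∧ Yᶜ.card = k then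
    V ⟨X, h.1⟩ ⟨Yᶜ, h.2⟩ * holeSign A Yᶜ else 0)

theorem unblock_apply (A : Finset Λ) (k : ℕ) (V : Matrix (Config Λ k) (Config Λ k) ℂ)
    (X Y : Finset Λ) :
    unblock A k V (X, Y) = if h : X.card = k ∧ Yᶜ.card = k then
      V ⟨X, h.1⟩ ⟨Yᶜ, h.2⟩ * holeSign A Yᶜ else 0 := rfl

theorem block_unblock (A : Finset Λ) (k : ℕ) (V : Matrix (Config Λ k) (Config Λ k) ℂ) :
    block A k (unblock A k V) = V := by
  ext X Z
  rw [block_apply, unblock_apply, dif_pos ⟨X.2, by rw [compl_compl]; exact Z.2⟩]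
  simp only [compl_compl]
  rw [mul_assoc, holeSign_mul_self, mul_one]

theorem unblock_block (A : Finset Λ) (k : ℕ) {Φ : Fock Λ}
    (hΦ : ∀ X Y, ¬ (X.card = k ∧ Yᶜ.card = k) → Φ (X, Y) = 0) :
    unblock A k (block A k Φ) = Φ := by
  ext ⟨X, Y⟩
  rw [unblock_apply]
  split_ifs with h
  · rw [block_apply]
    simp only [compl_compl]
    rw [mul_assoc, holeSign_mul_self, mul_one]
  · exact (hΦ X Y h).symm

/-- `unblock` is adjoint to `block`, hence isometric by `block_unblock`; this transports the
variational principle to matrices. -/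
theorem inner_unblock (A : Finset Λ) (k : ℕ) (V : Matrix (Config Λ k) (Config Λ k) ℂ)
    (Φ : Fock Λ) : inner ℂ (unblock A k V) Φ = (V.conjTranspose * block A k Φ).trace := by
  rw [inner_eq_trace, Matrix.trace, Matrix.trace, ← Equiv.sum_comp
    (Function.Involutive.toPerm (compl : Finset Λ → Finset Λ) compl_involutive),
    sum_eq_sum_config (k := k)]
  · refine Finset.sum_congr rfl fun Z _ => ?_
    rw [Matrix.diag_apply, Matrix.diag_apply, Matrix.mul_apply, Matrix.mul_apply,
      sum_eq_sum_config (k := k)]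
    · refine Finset.sum_congr rfl fun X _ => ?_
      have h := block_apply A k (unblock A k V) X Z
      rw [block_unblock] at h
      rw [Matrix.conjTranspose_apply, Matrix.conjTranspose_apply, h, block_apply, star_mul',
        star_holeSign]
      simp only [Function.Involutive.coe_toPerm, toMat_apply]
      linear_combination (-(star (unblock A k V (X.1, Z.1ᶜ)) * Φ (X.1, Z.1ᶜ))) *
        holeSign_mul_self A Z.1
    · intro X hX
      rw [Matrix.conjTranspose_apply, toMat_apply, unblock_apply, dif_neg (fun h => hX h.1)]
      simp
  · intro Z hZ
    rw [Matrix.diag_apply, Matrix.mul_apply]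
    refine Finset.sum_eq_zero fun X _ => ?_
    rw [Matrix.conjTranspose_apply, toMat_apply, unblock_apply,
      dif_neg (fun h => hZ (by simpa using h.2))]
    simp

/-- A diagonal wave function means that the down holes sit exactly on the up electrons. A spin flip
at `x` acts on both at once and keeps the wave function diagonal, so the ladder operators act on the
weight `g` alone. -/
theorem collective_raise_diagonal (A : Finset Λ) (g : Finset Λ → ℂ) :
    collective Λ 0 1 (toMat.symm (Matrix.diagonal g * (holeMatrix A).transpose)) =
      toMat.symm (Matrix.diagonal (fun X => ∑ x ∈ X, sublatticeSign A x *
        ((-1) ^ (X.erase x).card * g (X.erase x))) * (holeMatrix A).transpose) := by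
  apply toMat.injective
  rw [LinearEquiv.apply_symm_apply, collective, LinearMap.sum_apply, map_sum]
  have h1 : ∀ x : Λ, toMat (transfer x 0 x 1 (toMat.symm
      (Matrix.diagonal g * (holeMatrix A).transpose))) = Matrix.diagonal (fun X : Finset Λ =>
        if x ∈ X then sublatticeSign A x * ((-1) ^ (X.erase x).card * g (X.erase x)) else 0) *
          (holeMatrix A).transpose := by
    intro x
    have h2 := creationMatrix_mul_diagonal_mul x fun X => (-1) ^ X.card * g X
    rw [← Matrix.diagonal_mul_diagonal] at h2
    rw [transfer, Module.End.mul_apply, toMat_create_up, toMat_annihilate_down,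
      LinearEquiv.apply_symm_apply, Matrix.mul_assoc, Matrix.mul_assoc,
      transpose_holeMatrix_mul_creationMatrix, Matrix.mul_smul, Matrix.mul_smul, Matrix.mul_smul,
      ← Matrix.mul_assoc, ← Matrix.mul_assoc, ← Matrix.mul_assoc,
      Matrix.mul_assoc (creationMatrix x), parity, numDiag, h2, ← Matrix.smul_mul, ← Matrix.diagonal_smul]
    congr 2
    ext X
    simp
  simp only [h1, ← Finset.sum_mul]
  congr 1
  ext X Y
  rw [Matrix.sum_apply]
  by_cases h : X = Y
  · subst h; simp
  · simp [h]

theorem collective_lower_diagonal (A : Finset Λ) (g : Finset Λ → ℂ) :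
    collective Λ 1 0 (toMat.symm (Matrix.diagonal g * (holeMatrix A).transpose)) =
      toMat.symm (Matrix.diagonal (fun X => ∑ x ∈ Xᶜ, sublatticeSign A x *
        ((-1) ^ X.card * g (insert x X))) * (holeMatrix A).transpose) := by
  apply toMat.injective
  rw [LinearEquiv.apply_symm_apply, collective, LinearMap.sum_apply, map_sum]
  have h1 : ∀ x : Λ, toMat (transfer x 1 x 0 (toMat.symm
      (Matrix.diagonal g * (holeMatrix A).transpose))) = Matrix.diagonal (fun X : Finset Λ =>
        if x ∈ Xᶜ then sublatticeSign A x * ((-1) ^ X.card * g (insert x X)) else 0) *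
          (holeMatrix A).transpose := by
    intro x
    have h2 := transpose_creationMatrix_mul_diagonal_mul x g
    rw [transfer, Module.End.mul_apply, toMat_create_down, toMat_annihilate_up,
      LinearEquiv.apply_symm_apply, Matrix.mul_assoc, Matrix.mul_assoc, Matrix.mul_assoc,
      transpose_holeMatrix_mul_transpose_creationMatrix, Matrix.mul_smul, Matrix.mul_smul,
      Matrix.mul_smul, ← Matrix.mul_assoc, ← Matrix.mul_assoc, ← Matrix.mul_assoc,
      Matrix.mul_assoc (parity Λ), Matrix.mul_assoc (parity Λ), h2, parity, numDiag,
      Matrix.diagonal_mul_diagonal, ← Matrix.smul_mul, ← Matrix.diagonal_smul]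
    congr 2
    ext X
    by_cases hx : x ∈ X <;> simp [hx]
  simp only [h1, ← Finset.sum_mul]
  congr 1
  ext X Y
  rw [Matrix.sum_apply]
  by_cases h : X = Y
  · subst h; simp [Finset.sum_ite, Finset.filter_notMem_eq_sdiff, ← Finset.compl_eq_univ_sdiff]
  · simp [h]

end Block

/-! ### A positive reference state with known spin -/

section FerrimagneticState

variable {Λ : Type*} [Fintype Λ] [DecidableEq Λ]

open Nat in
/-- The amplitude of a spin configuration in the states that couple the maximal spins of the two
sublattices to the smallest possible total spin; it depends on the number of up spins on the
larger sublattice `A` only. -/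
def ferriWeight (A X : Finset Λ) : ℝ := (X ∩ A).card ! * (A.card - (X ∩ A).card)!

theorem ferriWeight_pos (A X : Finset Λ) : 0 < ferriWeight A X := by
  unfold ferriWeight; positivity

/-- The state with `k` up spins in which the maximal spins of `A` and of its complement are
coupled to the smallest possible total spin. -/
def ferriState (A : Finset Λ) (k : ℕ) : Fock Λ :=
  unblock A k (Matrix.diagonal fun X => (ferriWeight A X.1 : ℂ))

theorem ferriState_eq (A : Finset Λ) (k : ℕ) :
    ferriState A k = toMat.symm (Matrix.diagonal
      (fun X => if X.card = k then (ferriWeight A X : ℂ) else 0) * (holeMatrix A).transpose) := by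
  apply toMat.injective
  rw [LinearEquiv.apply_symm_apply]
  ext X Y
  rw [toMat_apply, ferriState, unblock_apply, mul_transpose_holeMatrix_apply]
  by_cases hXY : X = Yᶜ
  · subst hXY
    by_cases hk : (Yᶜ).card = k <;> simp [hk]
  · by_cases hk : X.card = k <;> by_cases hl : (Yᶜ).card = k <;> simp [hk, hl, hXY]

/-- Let `p` and `q` count the sites of `X` inside and outside `A`. The first contribute `(|A| - p +
1)` times the weight, the second `-q` times it. The total depends only on `p + q = k + 1`; the
factorials are chosen for this. -/
theorem sum_ferriWeight_erase {A X : Finset Λ} {k : ℕ} (hk : (Aᶜ).card ≤ k) (hX : X.card = k + 1) :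
    ∑ x ∈ X, sublatticeSign A x * (ferriWeight A (X.erase x) : ℂ) =
      ((A.card : ℂ) - k) * ferriWeight A X := by
  have hq : (X \ A).card ≤ (Aᶜ).card := by
    apply Finset.card_le_card
    intro z hz
    simpa using (Finset.mem_sdiff.mp hz).2
  have hpq := Finset.card_sdiff_add_card_inter X A
  have hpa : (X ∩ A).card ≤ A.card := Finset.card_le_card Finset.inter_subset_right
  have h1 : ∀ x ∈ X ∩ A, sublatticeSign A x * (ferriWeight A (X.erase x) : ℂ) =
      ((X ∩ A).card - 1).factorial * (A.card - (X ∩ A).card + 1).factorial := by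
    intro x hx
    have hx' := Finset.mem_inter.mp hx
    rw [sublatticeSign, if_pos hx'.2, ferriWeight, Finset.erase_inter, Finset.card_erase_of_mem hx]
    have : 0 < (X ∩ A).card := Finset.card_pos.mpr ⟨x, hx⟩
    rw [show A.card - ((X ∩ A).card - 1) = A.card - (X ∩ A).card + 1 by omega]
    push_cast; ring
  have h2 : ∀ x ∈ X \ A, sublatticeSign A x * (ferriWeight A (X.erase x) : ℂ) =
      -ferriWeight A X := by
    intro x hx
    have hx' := Finset.mem_sdiff.mp hx
    rw [sublatticeSign, if_neg hx'.2, ferriWeight, Finset.erase_inter,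
      Finset.erase_eq_of_notMem (by simp [hx'.2]), ← ferriWeight]
    ring
  rw [← Finset.sum_sdiff (Finset.inter_subset_left : X ∩ A ⊆ X), Finset.sdiff_inter_self_left,
    Finset.sum_congr rfl h1, Finset.sum_congr rfl h2, Finset.sum_const, Finset.sum_const]
  -- `X` meets `A` because `|Aᶜ| ≤ k < |X|`. Otherwise the first sum would be empty and the formula
  -- would fail.
  obtain ⟨p, hp⟩ : ∃ p, (X ∩ A).card = p + 1 := ⟨(X ∩ A).card - 1, by omega⟩
  obtain ⟨r, hr⟩ : ∃ r, A.card = p + 1 + r := ⟨A.card - (p + 1), by omega⟩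
  have hqk : (X \ A).card + p = k := by omega
  rw [ferriWeight, hp, hr, ← hqk, show p + 1 + r - (p + 1) = r by omega,
    show p + 1 - 1 = p by omega, Nat.factorial_succ r, Nat.factorial_succ p]
  push_cast [nsmul_eq_mul]
  ring

theorem sum_ferriWeight_insert {A X : Finset Λ} {k : ℕ} (hk : k < A.card) (hX : X.card = k) :
    ∑ x ∈ Xᶜ, sublatticeSign A x * (ferriWeight A (insert x X) : ℂ) =
      ((k : ℂ) + 1 - (Aᶜ).card) * ferriWeight A X := by
  have hpq := Finset.card_sdiff_add_card_inter X A
  have hA := Finset.card_sdiff_add_card_inter A X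
  have hB := Finset.card_sdiff_add_card_inter Aᶜ X
  have hXB : Aᶜ ∩ X = X \ A := by ext z; simp [and_comm]
  rw [Finset.inter_comm] at hA
  rw [hXB] at hB
  have h1 : ∀ x ∈ A \ X, sublatticeSign A x * (ferriWeight A (insert x X) : ℂ) =
      ((X ∩ A).card + 1).factorial * (A.card - (X ∩ A).card - 1).factorial := by
    intro x hx
    have hx' := Finset.mem_sdiff.mp hx
    rw [sublatticeSign, if_pos hx'.1, ferriWeight, Finset.insert_inter_of_mem hx'.1,
      Finset.card_insert_of_notMem (by simp [hx'.2]), Nat.sub_add_eq]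
    push_cast; ring
  have h2 : ∀ x ∈ Aᶜ \ X, sublatticeSign A x * (ferriWeight A (insert x X) : ℂ) =
      -ferriWeight A X := by
    intro x hx
    have hx' := Finset.mem_sdiff.mp hx
    have hxA : x ∉ A := by simpa using hx'.1
    rw [sublatticeSign, if_neg hxA, ferriWeight, Finset.insert_inter_of_notMem hxA, ← ferriWeight]
    ring
  have hu : Xᶜ = (A \ X) ∪ (Aᶜ \ X) := by
    ext z; by_cases hz : z ∈ A <;> simp [hz]
  have hd : Disjoint (A \ X) (Aᶜ \ X) :=
    disjoint_compl_right.mono Finset.sdiff_subset Finset.sdiff_subset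
  rw [hu, Finset.sum_union hd, Finset.sum_congr rfl h1, Finset.sum_congr rfl h2, Finset.sum_const,
    Finset.sum_const]
  -- Here `k < |A|` leaves a free site in `A`. The two sums contribute the factors `p + 1` and
  -- `-(|Aᶜ| - q)`, where `p + q = k`.
  obtain ⟨r, hr⟩ : ∃ r, A.card = (X ∩ A).card + r + 1 := ⟨A.card - (X ∩ A).card - 1, by omega⟩
  have hAr : (A \ X).card = r + 1 := by omega
  rw [ferriWeight, hAr, hr, ← hB, ← hX, ← hpq,
    show (X ∩ A).card + r + 1 - (X ∩ A).card = r + 1 by omega, show r + 1 - 1 = r by omega,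
    Nat.factorial_succ r, Nat.factorial_succ (X ∩ A).card]
  push_cast [nsmul_eq_mul]
  ring

theorem collective_raise_ferriState {A : Finset Λ} {k : ℕ} (hk : (Aᶜ).card ≤ k) :
    collective Λ 0 1 (ferriState A k) =
      ((-1) ^ k * ((A.card : ℂ) - k)) • ferriState A (k + 1) := by
  rw [ferriState_eq, ferriState_eq, collective_raise_diagonal, ← map_smul, ← Matrix.smul_mul,
    ← Matrix.diagonal_smul]
  congr 3
  ext X
  rw [Pi.smul_apply, smul_eq_mul]
  by_cases hX : X.card = k + 1
  · rw [if_pos hX, mul_assoc, ← sum_ferriWeight_erase hk hX, Finset.mul_sum]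
    refine Finset.sum_congr rfl fun x hx => ?_
    have hc : (X.erase x).card = k := by rw [Finset.card_erase_of_mem hx, hX]; rfl
    rw [if_pos hc, hc]
    ring
  · rw [if_neg hX, mul_zero]
    refine Finset.sum_eq_zero fun x hx => ?_
    have hc : (X.erase x).card ≠ k := fun h => hX (by rw [← h, Finset.card_erase_add_one hx])
    rw [if_neg hc]
    ring

theorem collective_lower_ferriState {A : Finset Λ} {k : ℕ} (hk : k < A.card) :
    collective Λ 1 0 (ferriState A (k + 1)) =
      ((-1) ^ k * ((k : ℂ) + 1 - (Aᶜ).card)) • ferriState A k := by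
  rw [ferriState_eq, ferriState_eq, collective_lower_diagonal, ← map_smul, ← Matrix.smul_mul,
    ← Matrix.diagonal_smul]
  congr 3
  ext X
  rw [Pi.smul_apply, smul_eq_mul]
  by_cases hX : X.card = k
  · rw [if_pos hX, mul_assoc, ← sum_ferriWeight_insert hk hX, Finset.mul_sum]
    refine Finset.sum_congr rfl fun x hx => ?_
    have hc : (insert x X).card = k + 1 := by
      rw [Finset.card_insert_of_notMem (Finset.mem_compl.mp hx), hX]
    rw [if_pos hc, hX]
    ring
  · rw [if_neg hX, mul_zero]
    refine Finset.sum_eq_zero fun x hx => ?_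
    have hc : (insert x X).card ≠ k + 1 := fun h => hX (by
      rw [Finset.card_insert_of_notMem (Finset.mem_compl.mp hx)] at h; omega)
    rw [if_neg hc]
    ring

theorem collective_lower_raise_ferriState {A : Finset Λ} {k : ℕ} (hbk : (Aᶜ).card ≤ k)
    (hka : k ≤ A.card) :
    collective Λ 1 0 (collective Λ 0 1 (ferriState A k)) =
      (((A.card : ℂ) - k) * (k + 1 - (Aᶜ).card)) • ferriState A k := by
  rw [collective_raise_ferriState hbk, map_smul]
  -- At `k = |A|` the factor `|A| - k` already vanishes; the lowering formula, which requires `k <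
  -- |A|`, is not needed there.
  rcases hka.eq_or_lt with h | h
  · simp [h]
  · rw [collective_lower_ferriState h, smul_smul]
    congr 1
    have : ((-1 : ℂ) ^ k) * (-1) ^ k = 1 := by rw [← mul_pow]; simp
    linear_combination (((A.card : ℂ) - k) * (k + 1 - (Aᶜ).card)) * this

end FerrimagneticState

/-! ### The variational principle in an invariant subspace -/

section Variational

/-- The variational principle in an invariant subspace: there is a lowest eigenvalue. -/
theorem exists_isLeast_eigenvalue {E : Type*} [NormedAddCommGroup E] [InnerProductSpace ℂ E]
    [FiniteDimensional ℂ E] {T : Module.End ℂ E} (hT : T.IsSymmetric) {S : Submodule ℂ E}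
    (hS : ∀ v ∈ S, T v ∈ S) (hne : S ≠ ⊥) :
    ∃ e : ℝ, IsLeast {e : ℝ | ∃ v ∈ S, v ≠ 0 ∧ T v = (e : ℂ) • v} e ∧
      ∀ v ∈ S, e * ‖v‖ ^ 2 ≤ (inner ℂ v (T v)).re := by
  have hR : (T.restrict hS).IsSymmetric := hT.restrict_invariant hS
  obtain ⟨w, hw, hw0⟩ := S.ne_bot_iff.mp hne
  have : Nontrivial S := ⟨⟨w, hw⟩, 0, fun h => hw0 (congrArg Subtype.val h)⟩
  set ev := hR.eigenvalues rfl with hev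
  set b := hR.eigenvectorBasis rfl with hb
  have hpos : 0 < Module.finrank ℂ S := Module.finrank_pos
  have : Nonempty (Fin (Module.finrank ℂ S)) := ⟨⟨0, hpos⟩⟩
  obtain ⟨i₀, hi₀⟩ := Finite.exists_min ev
  have hray : ∀ v ∈ S, ev i₀ * ‖v‖ ^ 2 ≤ (inner ℂ v (T v)).re := by
    intro v hv
    have h1 : inner ℂ v (T v) = inner ℂ (⟨v, hv⟩ : S) (T.restrict hS ⟨v, hv⟩) := rfl
    have h2 : ∀ i, inner ℂ (b i) (T.restrict hS ⟨v, hv⟩) =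
        (ev i : ℂ) * inner ℂ (b i) (⟨v, hv⟩ : S) := by
      intro i
      rw [← hR, hR.apply_eigenvectorBasis, inner_smul_left]
      simp [hev, hb]
    have h3 : ‖v‖ ^ 2 = ∑ i, ‖inner ℂ (b i) (⟨v, hv⟩ : S)‖ ^ 2 :=
      (b.sum_sq_norm_inner_right (⟨v, hv⟩ : S)).symm
    have h4 : (inner ℂ v (T v)).re = ∑ i, ev i * ‖inner ℂ (b i) (⟨v, hv⟩ : S)‖ ^ 2 := by
      rw [h1, ← b.sum_inner_mul_inner, Complex.re_sum]
      refine Finset.sum_congr rfl fun i _ => ?_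
      rw [h2, ← inner_conj_symm, mul_left_comm, ← Complex.normSq_eq_conj_mul_self,
        ← Complex.ofReal_mul, Complex.ofReal_re, Complex.normSq_eq_norm_sq]
    rw [h3, h4, Finset.mul_sum]
    exact Finset.sum_le_sum fun i _ => mul_le_mul_of_nonneg_right (hi₀ i) (by positivity)
  refine ⟨ev i₀, ⟨⟨b i₀, (b i₀).2, ?_, ?_⟩, ?_⟩, hray⟩
  · intro h
    have := b.norm_eq_one i₀
    rw [← Submodule.norm_coe, h, norm_zero] at this
    exact zero_ne_one this
  · exact congrArg Subtype.val (hR.apply_eigenvectorBasis rfl i₀)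
  · rintro e ⟨v, hv, hv0, hTv⟩
    have h1 := hray v hv
    rw [hTv, inner_smul_right, inner_self_eq_norm_sq_to_K] at h1
    have h2 : ((e : ℂ) * ((‖v‖ : ℂ)) ^ 2).re = e * ‖v‖ ^ 2 := by
      rw [← Complex.ofReal_pow, ← Complex.ofReal_mul, Complex.ofReal_re]
    have h3 : 0 < ‖v‖ ^ 2 := by positivity
    rw [show ((e : ℂ) * ((RCLike.ofReal ‖v‖ : ℂ)) ^ 2).re = e * ‖v‖ ^ 2 from h2] at h1
    exact le_of_mul_le_mul_right h1 h3

end Variational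

/-! ### Ground states with a fixed number of up electrons and the spin ladder -/

section GroundStates

variable {Λ : Type*} [Fintype Λ] [DecidableEq Λ]

theorem totalNumber_apply (Φ : Fock Λ) (X Y : Finset Λ) :
    totalNumber Λ Φ (X, Y) = (X.card + Y.card) * Φ (X, Y) := by
  rw [totalNumber_eq, LinearMap.add_apply, PiLp.add_apply, collective_up_apply,
    collective_down_apply, add_mul]

theorem mem_sector_iff {N : ℕ} {Φ : Fock Λ} :
    Φ ∈ sector Λ N ↔ ∀ X Y, X.card + Y.card ≠ N → Φ (X, Y) = 0 := by
  rw [sector, Module.End.mem_eigenspace_iff]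
  constructor
  · intro h X Y hXY
    have h1 : totalNumber Λ Φ (X, Y) = ((N : ℂ) • Φ) (X, Y) := by rw [h]
    rw [totalNumber_apply, PiLp.smul_apply, smul_eq_mul, ← sub_eq_zero, ← sub_mul] at h1
    refine (mul_eq_zero.mp h1).resolve_left fun h2 => hXY ?_
    have h3 : (X.card + Y.card : ℂ) = N := sub_eq_zero.mp h2
    exact_mod_cast h3
  · intro h
    ext ⟨X, Y⟩
    rw [totalNumber_apply, PiLp.smul_apply, smul_eq_mul]
    by_cases hXY : X.card + Y.card = N
    · rw [← hXY]; push_cast; ring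
    · rw [h X Y hXY]; simp

theorem hamiltonian_mem_sector (t : Matrix Λ Λ ℝ) (U : Λ → ℝ) {N : ℕ} {Φ : Fock Λ}
    (hΦ : Φ ∈ sector Λ N) : hamiltonian t U Φ ∈ sector Λ N := by
  rw [sector, Module.End.mem_eigenspace_iff] at hΦ ⊢
  rw [← map_smul, ← hΦ, totalNumber_eq]
  simp only [LinearMap.add_apply, map_add, hamiltonian_collective]

theorem sector_card_ne_bot : sector Λ (Fintype.card Λ) ≠ ⊥ := by
  rw [Submodule.ne_bot_iff]
  refine ⟨occ ∅ Finset.univ, mem_sector_iff.mpr fun X Y hXY => ?_, fun h => ?_⟩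
  · rw [occ, PiLp.single_apply, if_neg]
    rintro h
    rw [Prod.mk.injEq] at h
    exact hXY (by rw [h.1, h.2]; simp)
  · have := congrArg (fun Ψ : Fock Λ => Ψ (∅, Finset.univ)) h
    simp [occ] at this

theorem isLeast_groundEnergy {t : Matrix Λ Λ ℝ} (ht : t.IsSymm) (U : ℝ) :
    IsLeast (energies (hamiltonian t fun _ => U) (Fintype.card Λ))
        (groundEnergy (hamiltonian t fun _ => U) (Fintype.card Λ)) ∧
      ∀ Φ ∈ sector Λ (Fintype.card Λ),
        groundEnergy (hamiltonian t fun _ => U) (Fintype.card Λ) * ‖Φ‖ ^ 2 ≤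
          (inner ℂ Φ (hamiltonian t (fun _ => U) Φ)).re := by
  obtain ⟨e, he, hray⟩ := exists_isLeast_eigenvalue (isSymmetric_hamiltonian ht U)
    (fun Φ hΦ => hamiltonian_mem_sector t _ hΦ) (sector_card_ne_bot (Λ := Λ))
  have : groundEnergy (hamiltonian t fun _ => U) (Fintype.card Λ) = e := he.csInf_eq
  rw [this]
  exact ⟨he, hray⟩

/-- The half-filled ground states with `k` up-spin electrons. -/
def groundLevel (t : Matrix Λ Λ ℝ) (U : ℝ) (k : ℕ) : Submodule ℂ (Fock Λ) :=
  groundSpace (hamiltonian t fun _ => U) (Fintype.card Λ) ⊓ (collective Λ 0 0).eigenspace (k : ℂ)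

variable {t : Matrix Λ Λ ℝ} {U : ℝ} {A B : Finset Λ} {k : ℕ} {Φ : Fock Λ}

theorem mem_groundLevel_iff : Φ ∈ groundLevel t U k ↔
    (collective Λ 0 0 Φ + collective Λ 1 1 Φ = (Fintype.card Λ : ℂ) • Φ ∧
      hamiltonian t (fun _ => U) Φ =
        (groundEnergy (hamiltonian t fun _ => U) (Fintype.card Λ) : ℂ) • Φ) ∧
      collective Λ 0 0 Φ = (k : ℂ) • Φ := by
  rw [groundLevel, groundSpace, sector, Submodule.mem_inf, Submodule.mem_inf,
    Module.End.mem_eigenspace_iff, Module.End.mem_eigenspace_iff, Module.End.mem_eigenspace_iff,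
    totalNumber_eq]
  rfl

theorem collective_up_eq_iff : collective Λ 0 0 Φ = (k : ℂ) • Φ ↔
    ∀ X Y, X.card ≠ k → Φ (X, Y) = 0 := by
  constructor
  · intro h X Y hX
    have h1 : collective Λ 0 0 Φ (X, Y) = ((k : ℂ) • Φ) (X, Y) := by rw [h]
    rw [collective_up_apply, PiLp.smul_apply, smul_eq_mul, ← sub_eq_zero, ← sub_mul] at h1
    refine (mul_eq_zero.mp h1).resolve_left fun h2 => hX ?_
    have h3 : (X.card : ℂ) = k := sub_eq_zero.mp h2
    exact_mod_cast h3
  · intro h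
    ext ⟨X, Y⟩
    rw [collective_up_apply, PiLp.smul_apply, smul_eq_mul]
    by_cases hX : X.card = k
    · rw [hX]
    · rw [h X Y hX]; simp

/-- Half filling enters here: `k` up electrons leave `|Λ| - k` down electrons, that is `k` down
holes, so the state is captured by one square block. -/
theorem apply_eq_zero_of_mem_groundLevel (hΦ : Φ ∈ groundLevel t U k) (X Y : Finset Λ)
    (h : ¬ (X.card = k ∧ Yᶜ.card = k)) : Φ (X, Y) = 0 := by
  by_cases hX : X.card = k
  · refine mem_sector_iff.mp hΦ.1.1 X Y fun hXY => h ⟨hX, ?_⟩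
    rw [Finset.card_compl]
    omega
  · exact collective_up_eq_iff.mp (mem_groundLevel_iff.mp hΦ).2 X Y hX

theorem unblock_mem_sector (A : Finset Λ) (k : ℕ) (V : Matrix (Config Λ k) (Config Λ k) ℂ) :
    unblock A k V ∈ sector Λ (Fintype.card Λ) := by
  refine mem_sector_iff.mpr fun X Y hXY => ?_
  rw [unblock_apply, dif_neg]
  rintro ⟨h1, h2⟩
  rw [Finset.card_compl] at h2
  have := Finset.card_le_univ Y
  omega

theorem inner_ferriState (A : Finset Λ) (k : ℕ) (Φ : Fock Λ) :
    inner ℂ (ferriState A k) Φ = ∑ X : Config Λ k, (ferriWeight A X.1 : ℂ) * block A k Φ X X := by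
  rw [ferriState, inner_unblock, Matrix.diagonal_conjTranspose, Matrix.trace]
  refine Finset.sum_congr rfl fun X _ => ?_
  rw [Matrix.diag_apply, Matrix.diagonal_mul]
  simp

/-- Ground states with `k` up-spin electrons overlap with the ferrimagnetic state. -/
theorem eq_zero_of_inner_ferriState (ht : t.IsSymm) (hAB : IsBipartite t A B)
    (hc : IsConnected t) (hU : 0 < U) (hΦ : Φ ∈ groundLevel t U k)
    (h0 : inner ℂ (ferriState A k) Φ = 0) : Φ = 0 := by
  set E := groundEnergy (hamiltonian t fun _ => U) (Fintype.card Λ) with hE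
  have hblock : block A k Φ = 0 := by
    -- The energy is corrected by the constant `U k` of `block_hamiltonian`. The variational bound
    -- holds for all `V` because every `unblock A k V` is a half-filled trial state.
    refine eq_zero_of_reflectionHam_eq (E := E - U * k) hU (isHermitian_hopBlock ht k)
      (isHermitian_numberBlock k) (fun K hT hn => hc.eq_bot_or_eq_top ht K hT hn) ?_
      (fun X => ferriWeight_pos A X.1) ?_ ((inner_ferriState A k Φ).symm.trans h0)
    · intro V hV
      have h1 := (isLeast_groundEnergy ht U).2 _ (unblock_mem_sector A k V)
      have h2 : ‖unblock A k V‖ ^ 2 = (V * V).trace.re := by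
        have := inner_self_eq_norm_sq (𝕜 := ℂ) (unblock A k V)
        rw [inner_unblock, block_unblock, hV.eq] at this
        exact this.symm
      rw [inner_unblock, block_hamiltonian ht hAB, block_unblock, hV.eq, h2, mul_add,
        Matrix.trace_add, Matrix.mul_smul, Matrix.trace_smul, Complex.add_re, smul_eq_mul,
        Complex.re_ofReal_mul] at h1
      linarith
    · have h1 := congrArg (block A k) (mem_groundLevel_iff.mp hΦ).1.2
      rw [block_hamiltonian ht hAB, map_smul] at h1
      rw [eq_sub_of_add_eq h1, ← sub_smul]
      push_cast
      rfl
  rw [← unblock_block A k (apply_eq_zero_of_mem_groundLevel hΦ), hblock]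
  ext ⟨X, Y⟩
  rw [unblock_apply]
  split_ifs <;> simp

theorem inner_ferriState_of_ne {j : ℕ} (hjk : j ≠ k) (hΦ : Φ ∈ groundLevel t U k) :
    inner ℂ (ferriState A j) Φ = 0 := by
  rw [inner_ferriState]
  refine Finset.sum_eq_zero fun X _ => ?_
  rw [block_apply, apply_eq_zero_of_mem_groundLevel hΦ _ _ fun h => hjk (X.2.symm.trans h.1)]
  simp

theorem raise_mem_groundLevel (hΦ : Φ ∈ groundLevel t U k) :
    collective Λ 0 1 Φ ∈ groundLevel t U (k + 1) := by
  obtain ⟨⟨h1, h2⟩, h3⟩ := mem_groundLevel_iff.mp hΦ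
  have c0 := collective_collective (Λ := Λ) 0 0 0 1 Φ
  have c1 := collective_collective (Λ := Λ) 1 1 0 1 Φ
  simp only [if_true, Fin.isValue, one_ne_zero, if_false, sub_zero, zero_sub] at c0 c1
  refine mem_groundLevel_iff.mpr ⟨⟨?_, ?_⟩, ?_⟩
  · rw [c0, c1, ← map_smul, ← h1, map_add]; abel
  · rw [hamiltonian_collective, h2, map_smul]
  · rw [c0, h3, map_smul]; push_cast; module

theorem lower_mem_groundLevel (hΦ : Φ ∈ groundLevel t U (k + 1)) :
    collective Λ 1 0 Φ ∈ groundLevel t U k := by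
  obtain ⟨⟨h1, h2⟩, h3⟩ := mem_groundLevel_iff.mp hΦ
  have c0 := collective_collective (Λ := Λ) 0 0 1 0 Φ
  have c1 := collective_collective (Λ := Λ) 1 1 1 0 Φ
  simp only [if_true, Fin.isValue, zero_ne_one, if_false, sub_zero, zero_sub] at c0 c1
  refine mem_groundLevel_iff.mpr ⟨⟨?_, ?_⟩, ?_⟩
  · rw [c0, c1, ← map_smul, ← h1, map_add]; abel
  · rw [hamiltonian_collective, h2, map_smul]
  · rw [c0, h3, map_smul]; push_cast; module

theorem spinZ_of_mem_groundLevel (hΦ : Φ ∈ groundLevel t U k) :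
    collective Λ 0 0 Φ - collective Λ 1 1 Φ = (2 * k - Fintype.card Λ : ℂ) • Φ := by
  obtain ⟨⟨h1, _⟩, h3⟩ := mem_groundLevel_iff.mp hΦ
  rw [← eq_sub_iff_add_eq'] at h1
  rw [h1, h3]
  module

theorem raise_lower_of_mem_groundLevel (hΦ : Φ ∈ groundLevel t U k) :
    collective Λ 0 1 (collective Λ 1 0 Φ) =
      collective Λ 1 0 (collective Λ 0 1 Φ) + (2 * k - Fintype.card Λ : ℂ) • Φ := by
  rw [collective_collective, ← spinZ_of_mem_groundLevel hΦ]
  simp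

theorem raise_eq_zero (h : collective Λ 1 0 (collective Λ 0 1 Φ) = 0) :
    collective Λ 0 1 Φ = 0 := by
  rw [← inner_self_eq_zero (𝕜 := ℂ), inner_collective_left, h, inner_zero_right]

theorem lower_eq_zero (h : collective Λ 0 1 (collective Λ 1 0 Φ) = 0) :
    collective Λ 1 0 Φ = 0 := by
  rw [← inner_self_eq_zero (𝕜 := ℂ), inner_collective_left, h, inner_zero_right]

/-- A lowest-weight vector cannot have `S_z > 0`: the expectation of `S⁺S⁻` equals `‖S⁺Φ‖² + 2 S_z
‖Φ‖²`. -/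
theorem eq_zero_of_lower_eq_zero (hΦ : Φ ∈ groundLevel t U k) (hk : Fintype.card Λ < 2 * k)
    (h : collective Λ 1 0 Φ = 0) : Φ = 0 := by
  have h1 := raise_lower_of_mem_groundLevel hΦ
  rw [h, map_zero] at h1
  have h2 := congrArg (fun Ψ => (inner ℂ Φ Ψ).re) h1
  simp only [inner_zero_right, inner_add_right, ← inner_collective_left 0 1 Φ (collective Λ 0 1 Φ),
    Complex.add_re,
    inner_smul_right, Complex.zero_re] at h2
  have h3 : (2 * k - Fintype.card Λ : ℂ) = ((2 * k - Fintype.card Λ : ℝ) : ℂ) := by push_cast; rfl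
  rw [h3, Complex.re_ofReal_mul] at h2
  have h4 : 0 ≤ (inner ℂ (collective Λ 0 1 Φ) (collective Λ 0 1 Φ)).re :=
    inner_self_nonneg (𝕜 := ℂ)
  have h5 : 0 ≤ (inner ℂ Φ Φ).re :=
    inner_self_nonneg (𝕜 := ℂ)
  have h6 : (0 : ℝ) < 2 * k - Fintype.card Λ := by
    have : (Fintype.card Λ : ℝ) < 2 * k := by exact_mod_cast hk
    linarith
  have h7 : (inner ℂ Φ Φ).re = 0 := by nlinarith
  have h8 := inner_self_eq_norm_sq (𝕜 := ℂ) Φ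
  rw [← norm_eq_zero, ← sq_eq_zero_iff, ← h8]
  exact h7

theorem eq_zero_of_raise_eq_zero (hΦ : Φ ∈ groundLevel t U k) (hk : 2 * k < Fintype.card Λ)
    (h : collective Λ 0 1 Φ = 0) : Φ = 0 := by
  have h1 := raise_lower_of_mem_groundLevel hΦ
  rw [h, map_zero, zero_add] at h1
  have h2 := congrArg (fun Ψ => (inner ℂ Φ Ψ).re) h1
  simp only [← inner_collective_left 1 0 Φ (collective Λ 1 0 Φ), inner_smul_right] at h2
  have h3 : (2 * k - Fintype.card Λ : ℂ) = ((2 * k - Fintype.card Λ : ℝ) : ℂ) := by push_cast; rfl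
  rw [h3, Complex.re_ofReal_mul] at h2
  have h4 : 0 ≤ (inner ℂ (collective Λ 1 0 Φ) (collective Λ 1 0 Φ)).re :=
    inner_self_nonneg (𝕜 := ℂ)
  have h5 : 0 ≤ (inner ℂ Φ Φ).re :=
    inner_self_nonneg (𝕜 := ℂ)
  have h6 : (2 * k - Fintype.card Λ : ℝ) < 0 := by
    have : (2 * k : ℝ) < Fintype.card Λ := by exact_mod_cast hk
    linarith
  have h7 : (inner ℂ Φ Φ).re = 0 := by nlinarith
  have h8 := inner_self_eq_norm_sq (𝕜 := ℂ) Φ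
  rw [← norm_eq_zero, ← sq_eq_zero_iff, ← h8]
  exact h7

/-- The difference of the two sides is a ground state of the same level. It is orthogonal to
`ferriState`, since `S⁻S⁺` is self-adjoint and `ferriState` is its eigenvector with this real
eigenvalue; by positivity it vanishes. -/
theorem lower_raise_of_mem_groundLevel (ht : t.IsSymm) (hAB : IsBipartite t A B)
    (hc : IsConnected t) (hU : 0 < U) (hΦ : Φ ∈ groundLevel t U k) (hbk : (Aᶜ).card ≤ k)
    (hka : k ≤ A.card) :
    collective Λ 1 0 (collective Λ 0 1 Φ) =
      (((A.card : ℂ) - k) * (k + 1 - (Aᶜ).card)) • Φ := by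
  have hmem := lower_mem_groundLevel (raise_mem_groundLevel hΦ)
  rw [← sub_eq_zero]
  refine eq_zero_of_inner_ferriState ht hAB hc hU
    ((groundLevel t U k).sub_mem hmem ((groundLevel t U k).smul_mem _ hΦ)) ?_
  rw [inner_sub_right, ← inner_collective_left, ← inner_collective_left,
    collective_lower_raise_ferriState hbk hka, inner_smul_left, inner_smul_right]
  simp

variable (ht : t.IsSymm) (hAB : IsBipartite t A B) (hc : IsConnected t) (hU : 0 < U)
  (hle : (Aᶜ).card ≤ A.card)

include ht hAB hc hU hle

/-- `S⁺` annihilates the level `|A|`. A state one level higher is lowered into it, so its `S⁺S⁻`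
vanishes and with it `S⁻`, which is impossible for a nonzero state with `S_z > 0`. Higher levels
follow by lowering. -/
theorem groundLevel_eq_zero_of_gt (hk : A.card < k) (hΦ : Φ ∈ groundLevel t U k) : Φ = 0 := by
  have hN := Finset.card_add_card_compl A
  obtain ⟨j, rfl⟩ := Nat.exists_eq_add_of_lt hk
  induction j generalizing Φ with
  | zero =>
    have h1 := lower_mem_groundLevel hΦ
    refine eq_zero_of_lower_eq_zero hΦ (by omega) (lower_eq_zero ?_)
    apply raise_eq_zero
    rw [lower_raise_of_mem_groundLevel ht hAB hc hU h1 (by omega) (by omega)]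
    simp
  | succ j ih =>
    refine eq_zero_of_lower_eq_zero hΦ (by omega) (ih (by omega) ?_)
    exact lower_mem_groundLevel hΦ

theorem groundLevel_eq_zero_of_lt (hk : k < (Aᶜ).card) (hΦ : Φ ∈ groundLevel t U k) : Φ = 0 := by
  have hN := Finset.card_add_card_compl A
  obtain ⟨j, hj⟩ := Nat.exists_eq_add_of_lt hk
  induction j generalizing k Φ with
  | zero =>
    have h1 := raise_mem_groundLevel hΦ
    refine eq_zero_of_raise_eq_zero hΦ (by omega) (raise_eq_zero ?_)
    apply lower_eq_zero
    rw [raise_lower_of_mem_groundLevel h1,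
      lower_raise_of_mem_groundLevel ht hAB hc hU h1 (by omega) (by omega), ← add_smul, ← hN, hj]
    convert zero_smul ℂ _ using 2
    push_cast
    ring
  | succ j ih =>
    exact eq_zero_of_raise_eq_zero hΦ (by omega)
      (ih (by omega) (raise_mem_groundLevel hΦ) (by omega))

theorem raise_ne_zero (hbk : (Aᶜ).card ≤ k) (hka : k < A.card) (hΦ : Φ ∈ groundLevel t U k)
    (h0 : Φ ≠ 0) : collective Λ 0 1 Φ ≠ 0 := by
  intro h
  have h1 := lower_raise_of_mem_groundLevel ht hAB hc hU hΦ hbk hka.le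
  rw [h, map_zero, eq_comm, smul_eq_zero] at h1
  rcases mul_eq_zero.mp (h1.resolve_right h0) with h2 | h2
  · have : A.card = k := by exact_mod_cast sub_eq_zero.mp h2
    omega
  · have : k + 1 = (Aᶜ).card := by exact_mod_cast sub_eq_zero.mp h2
    omega

theorem lower_ne_zero (hbk : (Aᶜ).card ≤ k) (hka : k < A.card)
    (hΦ : Φ ∈ groundLevel t U (k + 1)) (h0 : Φ ≠ 0) : collective Λ 1 0 Φ ≠ 0 := by
  intro h
  have hN := Finset.card_add_card_compl A
  have h1 := raise_lower_of_mem_groundLevel hΦ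
  rw [lower_raise_of_mem_groundLevel ht hAB hc hU hΦ (by omega) hka, h, map_zero, ← add_smul,
    eq_comm, smul_eq_zero] at h1
  -- The eigenvalue of `S⁺S⁻` at level `k + 1` equals that of `S⁻S⁺` at level `k`.
  have h2 : ((A.card : ℂ) - k) * (k + 1 - (Aᶜ).card) = 0 := by
    rw [← h1.resolve_right h0, ← hN]
    push_cast
    ring
  rcases mul_eq_zero.mp h2 with h2 | h2
  · have : A.card = k := by exact_mod_cast sub_eq_zero.mp h2
    omega
  · have : k + 1 = (Aᶜ).card := by exact_mod_cast sub_eq_zero.mp h2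
    omega

end GroundStates

/-! ### Total spin and degeneracy of the ground space -/

section Lieb

variable {Λ : Type*} [Fintype Λ] [DecidableEq Λ]

/-- The component of a state with `k` up-spin electrons. -/
def upProj (k : ℕ) (Φ : Fock Λ) : Fock Λ :=
  toMat.symm (numDiag (fun n => if n = k then 1 else 0) * toMat Φ)

theorem upProj_apply (k : ℕ) (Φ : Fock Λ) (X Y : Finset Λ) :
    upProj k Φ (X, Y) = if X.card = k then Φ (X, Y) else 0 := by
  rw [← toMat_apply, upProj, LinearEquiv.apply_symm_apply, numDiag, Matrix.diagonal_mul,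
    toMat_apply]
  simp

theorem sum_upProj (Φ : Fock Λ) : ∑ k ∈ Finset.range (Fintype.card Λ + 1), upProj k Φ = Φ := by
  ext ⟨X, Y⟩
  rw [WithLp.ofLp_sum, Finset.sum_apply]
  simp only [upProj_apply]
  simp [Nat.lt_succ_of_le (Finset.card_le_univ X)]

theorem hamiltonian_upProj {t : Matrix Λ Λ ℝ} (ht : t.IsSymm) (U : ℝ) (k : ℕ) (Φ : Fock Λ) :
    hamiltonian t (fun _ => U) (upProj k Φ) = upProj k (hamiltonian t (fun _ => U) Φ) := by
  have hn : ∀ (g : ℕ → ℂ) (x : Λ) (W : Matrix (Finset Λ) (Finset Λ) ℂ),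
      numberMatrix x * (numDiag g * W) = numDiag g * (numberMatrix x * W) := by
    intro g x W
    rw [← Matrix.mul_assoc, ← Matrix.mul_assoc, numberMatrix, numDiag,
      Matrix.diagonal_mul_diagonal, Matrix.diagonal_mul_diagonal]
    simp only [mul_comm]
  apply toMat.injective
  rw [toMat_hamiltonian ht, upProj, upProj, LinearEquiv.apply_symm_apply,
    LinearEquiv.apply_symm_apply, toMat_hamiltonian ht]
  simp only [Matrix.mul_add, Matrix.mul_smul, Finset.mul_sum, Matrix.mul_assoc, hn]
  rw [← Matrix.mul_assoc (hopMatrix t), ← numDiag_mul_hopMatrix, Matrix.mul_assoc]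

variable {t : Matrix Λ Λ ℝ} {U : ℝ} {A B : Finset Λ}

theorem upProj_mem_groundLevel (ht : t.IsSymm) (k : ℕ) {Φ : Fock Λ}
    (hΦ : Φ ∈ groundSpace (hamiltonian t fun _ => U) (Fintype.card Λ)) :
    upProj k Φ ∈ groundLevel t U k := by
  refine ⟨⟨mem_sector_iff.mpr fun X Y hXY => ?_, ?_⟩, ?_⟩
  · rw [upProj_apply, mem_sector_iff.mp hΦ.1 X Y hXY, ite_self]
  · have h2 := Module.End.mem_eigenspace_iff.mp hΦ.2
    refine Module.End.mem_eigenspace_iff.mpr ?_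
    rw [hamiltonian_upProj ht, h2]
    ext ⟨X, Y⟩
    rw [upProj_apply, PiLp.smul_apply, PiLp.smul_apply, upProj_apply]
    split_ifs <;> simp
  · refine Module.End.mem_eigenspace_iff.mpr (collective_up_eq_iff.mpr fun X Y hX => ?_)
    rw [upProj_apply, if_neg hX]

theorem inner_ferriState_upProj (A : Finset Λ) (k : ℕ) (Φ : Fock Λ) :
    inner ℂ (ferriState A k) (upProj k Φ) = inner ℂ (ferriState A k) Φ := by
  rw [inner_ferriState, inner_ferriState]
  refine Finset.sum_congr rfl fun X _ => ?_
  rw [block_apply, block_apply, upProj_apply, if_pos X.2]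

variable (ht : t.IsSymm) (hAB : IsBipartite t A B) (hc : IsConnected t) (hU : 0 < U)
  (hle : (Aᶜ).card ≤ A.card)

include ht hAB hc hU hle

/-- With `S = (|A| - |Aᶜ|) / 2` and `m = k - |Λ| / 2`, the eigenvalue of `S⁻S⁺` is `(S - m)(S + m +
1)`; adding `m² + m` gives `S (S + 1)` for every `k`. Outside the range of the ladder the state is
zero. -/
theorem totalSpinSq_of_mem_groundLevel {k : ℕ} {Φ : Fock Λ} (hΦ : Φ ∈ groundLevel t U k) :
    totalSpinSq Λ Φ = (((A.card : ℂ) - (Aᶜ).card) / 2 * (((A.card : ℂ) - (Aᶜ).card) / 2 + 1)) •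
      Φ := by
  by_cases h1 : A.card < k
  · rw [groundLevel_eq_zero_of_gt ht hAB hc hU hle h1 hΦ]; simp
  by_cases h2 : k < (Aᶜ).card
  · rw [groundLevel_eq_zero_of_lt ht hAB hc hU hle h2 hΦ]; simp
  have hz := spinZ_of_mem_groundLevel hΦ
  rw [← LinearMap.sub_apply] at hz
  rw [totalSpinSq_apply, lower_raise_of_mem_groundLevel ht hAB hc hU hΦ (by omega) (by omega),
    Module.End.mul_apply, hz, map_smul, hz, ← Finset.card_add_card_compl A]
  push_cast
  module

/-- Some component of some ground state is nonzero, and its level must lie in the range. The ladder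
operators carry it, without annihilating it, to every other level there. -/
theorem exists_groundLevel_ne_zero {k : ℕ} (hbk : (Aᶜ).card ≤ k) (hka : k ≤ A.card) :
    ∃ Φ ∈ groundLevel t U k, Φ ≠ 0 := by
  obtain ⟨Φ, hΦs, hΦ0, hΦE⟩ := (isLeast_groundEnergy ht U).1.1
  have hΦ : Φ ∈ groundSpace (hamiltonian t fun _ => U) (Fintype.card Λ) :=
    ⟨hΦs, Module.End.mem_eigenspace_iff.mpr hΦE⟩
  obtain ⟨j, hj⟩ : ∃ j, upProj j Φ ≠ 0 := by
    by_contra! h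
    exact hΦ0 (by rw [← sum_upProj Φ]; simp [h])
  have hjm := upProj_mem_groundLevel ht j hΦ
  have hja : j ≤ A.card := by
    by_contra! h
    exact hj (groundLevel_eq_zero_of_gt ht hAB hc hU hle h hjm)
  have hbj : (Aᶜ).card ≤ j := by
    by_contra! h
    exact hj (groundLevel_eq_zero_of_lt ht hAB hc hU hle h hjm)
  have hstart : ∃ Φ ∈ groundLevel t U j, Φ ≠ 0 := ⟨_, hjm, hj⟩
  rcases le_total j k with hjk | hkj
  · induction k, hjk using Nat.le_induction with
    | base => exact hstart
    | succ k hk ih =>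
      obtain ⟨Ψ, hΨ, hΨ0⟩ := ih (by omega) (by omega)
      exact ⟨_, raise_mem_groundLevel hΨ,
        raise_ne_zero ht hAB hc hU hle (by omega) (by omega) hΨ hΨ0⟩
  · induction hkj using Nat.decreasingInduction with
    | self => exact hstart
    | of_succ k hk ih =>
      obtain ⟨Ψ, hΨ, hΨ0⟩ := ih (by omega) (by omega)
      exact ⟨_, lower_mem_groundLevel hΨ,
        lower_ne_zero ht hAB hc hU hle (by omega) (by omega) hΨ hΨ0⟩

theorem finrank_groundSpace :
    Module.finrank ℂ (groundSpace (hamiltonian t fun _ => U) (Fintype.card Λ)) =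
      A.card - (Aᶜ).card + 1 := by
  set d := A.card - (Aᶜ).card + 1
  -- The coordinates are the overlaps with the reference states at the levels from `|Aᶜ|` to `|A|`.
  -- Injectivity holds because a zero overlap kills a level, surjectivity because every level is
  -- nonzero.
  let ℓ : groundSpace (hamiltonian t fun _ => U) (Fintype.card Λ) →ₗ[ℂ] (Fin d → ℂ) :=
    (LinearMap.pi fun i : Fin d => (innerₛₗ ℂ (ferriState A ((Aᶜ).card + i)))) ∘ₗ
      Submodule.subtype _
  have hℓ : ∀ Φ i, ℓ Φ i = inner ℂ (ferriState A ((Aᶜ).card + i)) Φ.1 := fun _ _ => rfl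
  have hinj : Function.Injective ℓ := by
    rw [injective_iff_map_eq_zero]
    rintro ⟨Φ, hΦ⟩ h0
    have hproj : ∀ k, upProj k Φ = 0 := by
      intro k
      have hk := upProj_mem_groundLevel ht k hΦ
      by_cases h1 : A.card < k
      · exact groundLevel_eq_zero_of_gt ht hAB hc hU hle h1 hk
      by_cases h2 : k < (Aᶜ).card
      · exact groundLevel_eq_zero_of_lt ht hAB hc hU hle h2 hk
      refine eq_zero_of_inner_ferriState ht hAB hc hU hk ?_
      have h3 := congrFun h0 ⟨k - (Aᶜ).card, by omega⟩
      rw [hℓ] at h3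
      rw [inner_ferriState_upProj]
      simpa [Nat.add_sub_cancel' (not_lt.mp h2)] using h3
    apply Subtype.ext
    change Φ = 0
    rw [← sum_upProj Φ]
    simp [hproj]
  have hsurj : Function.Surjective ℓ := by
    rw [← LinearMap.range_eq_top, eq_top_iff]
    intro w _
    rw [pi_eq_sum_univ w]
    refine Submodule.sum_mem _ fun i _ => Submodule.smul_mem _ _ ?_
    obtain ⟨Φ, hΦ, hΦ0⟩ := exists_groundLevel_ne_zero ht hAB hc hU hle
      (k := (Aᶜ).card + i) (by omega) (by omega)
    have hov : inner ℂ (ferriState A ((Aᶜ).card + i)) Φ ≠ 0 := fun h =>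
      hΦ0 (eq_zero_of_inner_ferriState ht hAB hc hU hΦ h)
    refine ⟨(inner ℂ (ferriState A ((Aᶜ).card + i)) Φ)⁻¹ • ⟨Φ, hΦ.1⟩, ?_⟩
    rw [map_smul]
    ext j
    rw [Pi.smul_apply, hℓ, smul_eq_mul]
    by_cases hij : i = j
    · subst hij; simp [hov]
    · have hne : (Aᶜ).card + (j : ℕ) ≠ (Aᶜ).card + (i : ℕ) := fun h => hij (Fin.ext (by omega))
      rw [inner_ferriState_of_ne hne hΦ]
      simp [hij]
  rw [(LinearEquiv.ofBijective ℓ ⟨hinj, hsurj⟩).finrank_eq]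
  simp

omit hle in
theorem nondegenerateWithSpin_of_card_le (hBA : B.card ≤ A.card) :
    NondegenerateWithSpin (hamiltonian t fun _ => U) (Fintype.card Λ)
      (((A.card : ℝ) - B.card) / 2) := by
  have hB : B = Aᶜ := by
    refine (IsCompl.of_eq ?_ ?_).compl_eq.symm
    · exact Finset.disjoint_iff_inter_eq_empty.mp hAB.disjoint
    · exact hAB.union_eq
  subst hB
  have hle' : ((Aᶜ).card : ℝ) ≤ A.card := by exact_mod_cast hBA
  refine ⟨(isLeast_groundEnergy ht U).1, fun Φ hΦ => ⟨by linarith, ?_⟩, ?_⟩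
  · conv_lhs => rw [← sum_upProj Φ]
    conv_rhs => rw [← sum_upProj Φ]
    rw [map_sum, Finset.smul_sum]
    refine Finset.sum_congr rfl fun k _ => ?_
    rw [totalSpinSq_of_mem_groundLevel ht hAB hc hU hBA (upProj_mem_groundLevel ht k hΦ)]
    push_cast
    rfl
  · rw [finrank_groundSpace ht hAB hc hU hBA]
    push_cast [Nat.cast_sub hBA]
    ring

end Lieb

/-! ### Lieb's theorem, ferrimagnetism and the CuO lattice -/

section Main

variable {Λ : Type*} [Fintype Λ] [DecidableEq Λ]

/-- **Lieb's theorem** on the half-filled repulsive Hubbard model on a bipartite lattice. -/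
theorem IsLiebModel.nondegenerateWithSpin {t : Matrix Λ Λ ℝ} {A B : Finset Λ} {U : ℝ}
    (h : IsLiebModel t A B U) :
    NondegenerateWithSpin (hamiltonian t fun _ => U) (Fintype.card Λ)
      (|(A.card : ℝ) - (B.card : ℝ)| / 2) := by
  rcases le_total B.card A.card with hle | hle
  · rw [abs_of_nonneg (sub_nonneg.mpr (by exact_mod_cast hle))]
    exact nondegenerateWithSpin_of_card_le h.symm h.bipartite h.connected h.pos hle
  · have hBA : IsBipartite t B A :=
      ⟨h.bipartite.disjoint.symm, by rw [Finset.union_comm, h.bipartite.union_eq],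
        h.bipartite.right, h.bipartite.left⟩
    rw [abs_sub_comm, abs_of_nonneg (sub_nonneg.mpr (by exact_mod_cast hle))]
    exact nondegenerateWithSpin_of_card_le h.symm hBA h.connected h.pos hle

theorem isBroadlyFerromagnetic_of_isLiebModel {Λ : ℕ → Type*} [∀ n, Fintype (Λ n)]
    [∀ n, DecidableEq (Λ n)] {t : ∀ n, Matrix (Λ n) (Λ n) ℝ} {A B : ∀ n, Finset (Λ n)}
    {U : ℕ → ℝ} (h : ∀ n, IsLiebModel (t n) (A n) (B n) (U n))
    (hΛ : Tendsto (fun n => Fintype.card (Λ n)) atTop atTop)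
    (hS : (fun n => |((A n).card : ℝ) - ((B n).card : ℝ)|) =Θ[atTop]
      fun n => (Fintype.card (Λ n) : ℝ)) :
    IsBroadlyFerromagnetic (fun n => hamiltonian (t n) fun _ => U n)
      (fun n => Fintype.card (Λ n)) := by
  refine ⟨hΛ, fun n => |((A n).card : ℝ) - ((B n).card : ℝ)| / 2, fun n =>
    ⟨(h n).nondegenerateWithSpin.isLeast, (h n).nondegenerateWithSpin.hasTotalSpin⟩, ?_⟩
  have h2 : (fun n => |((A n).card : ℝ) - ((B n).card : ℝ)| / 2) =
      fun n => (1 / 2 : ℝ) * |((A n).card : ℝ) - ((B n).card : ℝ)| := by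
    ext n; ring
  rw [h2]
  exact (isTheta_const_mul_left (by norm_num)).mpr hS

/-- The black sites of the CuO lattice. -/
def blackSites (L : ℕ) [NeZero L] : Finset (CuOSite L) := Finset.univ.filter fun u => u.isLeft

/-- The white sites of the CuO lattice. -/
def whiteSites (L : ℕ) [NeZero L] : Finset (CuOSite L) := Finset.univ.filter fun u => u.isRight

theorem card_blackSites (L : ℕ) [NeZero L] : (blackSites L).card = L ^ 2 := by
  have : blackSites L = Finset.univ.map Function.Embedding.inl := by
    ext u; cases u <;> simp [blackSites]
  rw [this, Finset.card_map, Finset.card_univ, Fintype.card_prod, ZMod.card, sq]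

theorem card_whiteSites (L : ℕ) [NeZero L] : (whiteSites L).card = 2 * L ^ 2 := by
  have : whiteSites L = Finset.univ.map Function.Embedding.inr := by
    ext u; cases u <;> simp [whiteSites]
  rw [this, Finset.card_map, Finset.card_univ, Fintype.card_prod, Fintype.card_prod, ZMod.card,
    Fintype.card_fin]
  ring

theorem card_CuOSite (L : ℕ) [NeZero L] : Fintype.card (CuOSite L) = 3 * L ^ 2 := by
  rw [Fintype.card_sum, Fintype.card_prod, Fintype.card_prod, Fintype.card_prod, ZMod.card,
    Fintype.card_fin]
  ring

/-- Two bonds through a midpoint realize a unit step between black sites, and natural multiples of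
the unit vectors exhaust the torus. Each white site is adjacent to a black one. -/
theorem IsCuOHopping.isConnected {L : ℕ} [NeZero L] {t : Matrix (CuOSite L) (CuOSite L) ℝ}
    (h : IsCuOHopping t) : IsConnected t := by
  set R : CuOSite L → CuOSite L → Prop := Relation.ReflTransGen fun u v => t u v ≠ 0 with hR
  have hsymm : ∀ {u v}, R u v → R v u := by
    intro u v huv
    induction huv with
    | refl => exact Relation.ReflTransGen.refl
    | tail _ hbc ih => exact (Relation.ReflTransGen.single (by rwa [h.symm.apply])).trans ih
  have hbond : ∀ {u v}, CuOBond L u v → R u v := fun hb =>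
    Relation.ReflTransGen.single ((h.ne_zero_iff _ _).mpr hb)
  have hstep : ∀ (p : ZMod L × ZMod L) (d : Fin 2),
      R (Sum.inl p) (Sum.inl (p + unitVec L d)) := fun p d =>
    (hbond (show CuOBond L (Sum.inl p) (Sum.inr (p, d)) from Or.inl rfl)).trans
      (hbond (show CuOBond L (Sum.inr (p, d)) (Sum.inl (p + unitVec L d)) from Or.inr rfl))
  have h1 : ∀ (m : ℕ) (j : ZMod L), R (Sum.inl (0, j)) (Sum.inl ((m : ZMod L), j)) := by
    intro m j
    induction m with
    | zero => simpa using Relation.ReflTransGen.refl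
    | succ m ih => simpa [unitVec] using ih.trans (hstep _ 0)
  have h2 : ∀ m : ℕ, R (Sum.inl (0, 0)) (Sum.inl (0, (m : ZMod L))) := by
    intro m
    induction m with
    | zero => simpa using Relation.ReflTransGen.refl
    | succ m ih => simpa [unitVec] using ih.trans (hstep _ 1)
  have h0 : ∀ p : ZMod L × ZMod L, R (Sum.inl (0, 0)) (Sum.inl p) := by
    rintro ⟨i, j⟩
    have := (h2 j.val).trans (h1 i.val _)
    simpa using this
  have hall : ∀ u, R (Sum.inl (0, 0)) u := by
    rintro (p | ⟨q, d⟩)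
    · exact h0 p
    · exact (h0 q).trans
        (hbond (show CuOBond L (Sum.inl q) (Sum.inr (q, d)) from Or.inl rfl))
  exact fun u v => (hsymm (hall u)).trans (hall v)

theorem IsCuOHopping.isLiebModel {L : ℕ} [NeZero L] {t : Matrix (CuOSite L) (CuOSite L) ℝ}
    (h : IsCuOHopping t) (hL : Even L) {U : ℝ} (hU : 0 < U) :
    IsLiebModel t (blackSites L) (whiteSites L) U where
  symm := h.symm
  bipartite :=
    { disjoint := by
        rw [Finset.disjoint_left]
        rintro (p | p) <;> simp [blackSites, whiteSites]
      union_eq := by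
        ext u; cases u <;> simp [blackSites, whiteSites]
      left := by
        rintro (p | p) hp (q | q) hq <;> simp [blackSites] at hp hq
        by_contra hne
        exact (h.ne_zero_iff _ _).mp hne
      right := by
        rintro (p | p) hp (q | q) hq <;> simp [whiteSites] at hp hq
        by_contra hne
        exact (h.ne_zero_iff _ _).mp hne }
  even_card := by
    rw [card_CuOSite]
    exact (hL.pow_of_ne_zero two_ne_zero).mul_left 3
  connected := h.isConnected
  pos := hU

theorem abs_card_sub_card_CuO (L : ℕ) [NeZero L] :
    |((blackSites L).card : ℝ) - ((whiteSites L).card : ℝ)| = (L : ℝ) ^ 2 := by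
  rw [card_blackSites, card_whiteSites]
  push_cast
  rw [show (L : ℝ) ^ 2 - 2 * (L : ℝ) ^ 2 = -(L : ℝ) ^ 2 by ring, abs_neg,
    abs_of_nonneg (by positivity)]

end Main

end Hubbard

end

theorem mainTheorem1 :
    -- the ground states of the half-filled model
    (∀ (Λ : Type*) [Fintype Λ] [DecidableEq Λ] (t : Matrix Λ Λ ℝ) (A B : Finset Λ) (U : ℝ),
      Hubbard.IsLiebModel t A B U →
        Hubbard.NondegenerateWithSpin (Hubbard.hamiltonian t fun _ => U) (Fintype.card Λ)
          (|(A.card : ℝ) - (B.card : ℝ)| / 2)) ∧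
    -- ferrimagnetism on asymmetric bipartite lattices
    (∀ (Λ : ℕ → Type*) [∀ n, Fintype (Λ n)] [∀ n, DecidableEq (Λ n)]
      (t : ∀ n, Matrix (Λ n) (Λ n) ℝ) (A B : ∀ n, Finset (Λ n)) (U : ℕ → ℝ),
      (∀ n, Hubbard.IsLiebModel (t n) (A n) (B n) (U n)) →
      Tendsto (fun n => Fintype.card (Λ n)) atTop atTop →
      ((fun n => |((A n).card : ℝ) - ((B n).card : ℝ)|) =Θ[atTop]
        fun n => (Fintype.card (Λ n) : ℝ)) →
        Hubbard.IsBroadlyFerromagnetic (fun n => Hubbard.hamiltonian (t n) fun _ => U n)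
          (fun n => Fintype.card (Λ n))) ∧
    -- the CuO lattice
    (∀ (L : ℕ) [NeZero L] (t : Matrix (Hubbard.CuOSite L) (Hubbard.CuOSite L) ℝ) (U : ℝ),
      Even L → Hubbard.IsCuOHopping t → 0 < U →
        Fintype.card (Hubbard.CuOSite L) = 3 * L ^ 2 ∧
        Hubbard.NondegenerateWithSpin (Hubbard.hamiltonian t fun _ => U)
          (Fintype.card (Hubbard.CuOSite L)) ((L : ℝ) ^ 2 / 2)) ∧
    (∀ (L : ℕ → ℕ) [∀ n, NeZero (L n)]
      (t : ∀ n, Matrix (Hubbard.CuOSite (L n)) (Hubbard.CuOSite (L n)) ℝ) (U : ℕ → ℝ),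
      (∀ n, Even (L n)) → (∀ n, Hubbard.IsCuOHopping (t n)) → (∀ n, 0 < U n) →
      Tendsto L atTop atTop →
        Hubbard.IsBroadlyFerromagnetic (fun n => Hubbard.hamiltonian (t n) fun _ => U n)
          (fun n => Fintype.card (Hubbard.CuOSite (L n)))) := by
  refine ⟨fun Λ _ _ t A B U h => h.nondegenerateWithSpin, fun Λ _ _ t A B U h hΛ hS =>
    Hubbard.isBroadlyFerromagnetic_of_isLiebModel h hΛ hS, fun L _ t U hL ht hU =>
    ⟨Hubbard.card_CuOSite L, ?_⟩, fun L _ t U hL ht hU hLt => ?_⟩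
  · have h := (ht.isLiebModel hL hU).nondegenerateWithSpin
    rwa [Hubbard.abs_card_sub_card_CuO] at h
  · refine Hubbard.isBroadlyFerromagnetic_of_isLiebModel
      (fun n => (ht n).isLiebModel (hL n) (hU n)) ?_ ?_
    · refine tendsto_atTop_mono (fun n => ?_) hLt
      rw [Hubbard.card_CuOSite]
      nlinarith [Nat.zero_le (L n)]
    -- The imbalance `L²` is exactly one third of the `3 L²` sites.
    · have h3 : (fun n => |((Hubbard.blackSites (L n)).card : ℝ) -
          ((Hubbard.whiteSites (L n)).card : ℝ)|) =
            fun n => (1 / 3 : ℝ) * (Fintype.card (Hubbard.CuOSite (L n)) : ℝ) := by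
        ext n
        rw [Hubbard.abs_card_sub_card_CuO, Hubbard.card_CuOSite]
        push_cast
        ring
      rw [h3]
      exact (isTheta_const_mul_left (by norm_num)).mpr (isTheta_refl _ _)
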